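/- For $c\in\mathbb{R}$ let $\mathbb{H}_c=L^2(\mathbb{R},e^{-2ct}\,dt)$ (complex-valued functions), let $\partial_c f=f'$ be the infinitesimal shift with domain $D(\partial_c)=\{f\in\mathbb{H}_c : f \text{ locally absolutely continuous on } \mathbb{R},\ f'\in\mathbb{H}_c\}$, and let $V_c=\frac{1}{i}(\partial_c-c)$, an unbounded self-adjoint operator on $\mathbb{H}_c$ with domain $D(\partial_c)$; the spectral operator is $\mathfrak{a}_c=\zeta(\partial_c)=\zeta(c+iV_c)$, where $\zeta$ is the Riemann zeta function. For $0\le T_0<T$, a $(T_0,T)$-admissible cut-off function is a Borel function $\phi:\mathbb{R}\to\mathbb{R}$ whose essential range with respect to Lebesgue measure (for continuous $\phi$, this is the closure of the range) equals $\{\tau\in\mathbb{R} : T_0\le|\tau|\le T\}$. For every $c\in(\frac12,1)$ and all $0\le T_0<T$ choose any such function $\phi_c^{(T_0,T)}$, and let $$\mathfrak{a}_c^{(T_0,T)}=\zeta\big(c+i\,\phi_c^{(T_0,T)}(V_c)\big)$$ be the corresponding truncated spectral operator, where $\phi_c^{(T_0,T)}(V_c)$ is the bounded self-adjoint operator defined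 by the measurable functional calculus of $V_c$, and $\zeta$ is applied to the bounded normal operator $c+i\,\phi_c^{(T_0,T)}(V_c)$ by the functional calculus. The operator $\mathfrak{a}_c$ is called almost invertible if there is $T_0\ge 0$ (which may depend on $c$) such that $\mathfrak{a}_c^{(T_0,T)}$ is invertible with bounded inverse on $\mathbb{H}_c$ for all $T>T_0$. Theorem. For every such choice of cut-off functions, the spectral operator $\mathfrak{a}_c$ is almost invertible for all $c\in(\frac12,1)$ if and only if the Riemann hypothesis is almost true, that is, for every $c>\frac12$ there are at most finitely many zeros of $\zeta$ on the vertical line $\operatorname{Re}(s)=c$. -/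

import Mathlib

open MeasureTheory Filter Topology

namespace SpectralOp

/-! ### Borel functional calculus of a self-adjoint operator -/

section FunctionalCalculus

variable {H : Type*} [NormedAddCommGroup H] [InnerProductSpace ℂ H] [CompleteSpace H]

variable (H) in
/-- A projection-valued measure (resolution of the identity) on the Borel sets of `ℝ`, acting on the
Hilbert space `H`. The values of `proj` on non-measurable sets are irrelevant. -/
structure ProjectionValuedMeasure where
  /-- The orthogonal projection attached to a Borel set. -/
  proj : Set ℝ → H →L[ℂ] H
  isStarProjection : ∀ s, MeasurableSet s → IsStarProjection (proj s)
  proj_univ : proj Set.univ = 1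
  proj_inter : ∀ s t, MeasurableSet s → MeasurableSet t → proj (s ∩ t) = proj s * proj t
  hasSum_iUnion : ∀ s : ℕ → Set ℝ, (∀ n, MeasurableSet (s n)) →
    Pairwise (Function.onFun Disjoint s) →
    ∀ x : H, HasSum (fun n => proj (s n) x) (proj (⋃ n, s n) x)

namespace ProjectionValuedMeasure

variable (E : ProjectionValuedMeasure H)

theorem inner_proj_self (x : H) {s : Set ℝ} (hs : MeasurableSet s) :
    inner ℂ x (E.proj s x) = ((‖E.proj s x‖ ^ 2 : ℝ) : ℂ) := by
  have h := E.isStarProjection s hs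
  have h1 : E.proj s (E.proj s x) = E.proj s x := by
    have := congrArg (fun A : H →L[ℂ] H => A x) h.isIdempotentElem.eq
    simpa using this
  have h2 : inner ℂ (E.proj s x) (E.proj s x) = inner ℂ x (E.proj s (E.proj s x)) := by
    have h3 := ContinuousLinearMap.adjoint_inner_left (E.proj s) (E.proj s x) x
    have h4 : ContinuousLinearMap.adjoint (E.proj s) = E.proj s := h.isSelfAdjoint
    rwa [h4] at h3
  rw [h1] at h2
  rw [← h2, inner_self_eq_norm_sq_to_K]
  simp

theorem proj_empty : E.proj ∅ = 0 := by
  ext x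
  have h := E.hasSum_iUnion (fun _ => ∅) (fun _ => MeasurableSet.empty)
    (fun _ _ _ => by simp [Function.onFun]) x
  have h0 : E.proj ∅ x = 0 := tendsto_nhds_unique tendsto_const_nhds h.summable.tendsto_atTop_zero
  simpa using h0

/-- The finite positive Borel measure `s ↦ ⟪x, E(s) x⟫ = ‖E(s) x‖²`. -/
noncomputable def measure (x : H) : Measure ℝ :=
  Measure.ofMeasurable (fun s _ => ENNReal.ofReal (‖E.proj s x‖ ^ 2))
    (by simp [E.proj_empty])
    (by
      intro s hs hd
      have h := (E.hasSum_iUnion s hs hd x).mapL (innerSL ℂ x)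
      have h' : HasSum (fun n => ‖E.proj (s n) x‖ ^ 2) (‖E.proj (⋃ n, s n) x‖ ^ 2) := by
        rw [← Complex.hasSum_ofReal]
        simp only [innerSL_apply_apply, E.inner_proj_self x (MeasurableSet.iUnion hs),
          fun n => E.inner_proj_self x (hs n)] at h
        exact h
      rw [← h'.tsum_eq, ENNReal.ofReal_tsum_of_nonneg (fun n => by positivity) h'.summable])

/-- `V = ∫ t dE(t)`: the domain of `V` is the set of `x` with `∫ t² d⟪x, E(t) x⟫ < ∞`, and
`⟪x, V x⟫ = ∫ t d⟪x, E(t) x⟫` there. (By polarization this determines `V`.) -/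
def Resolves (V : H →ₗ.[ℂ] H) : Prop :=
  (∀ x : H, x ∈ V.domain ↔ Integrable (fun t : ℝ => t ^ 2) (E.measure x)) ∧
  ∀ x : V.domain, inner ℂ (x : H) (V x) = ∫ t : ℝ, (t : ℂ) ∂(E.measure (x : H))

end ProjectionValuedMeasure

/-- `B = g(V) = ∫ g dE`, a bounded operator, where `E` is the spectral measure of `V`. -/
def IsBorelCalculus (V : H →ₗ.[ℂ] H) (g : ℝ → ℂ) (B : H →L[ℂ] H) : Prop :=
  ∃ E : ProjectionValuedMeasure H, E.Resolves V ∧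
    ∀ x : H, Integrable g (E.measure x) ∧ inner ℂ x (B x) = ∫ t, g t ∂(E.measure x)

open Classical in
/-- The bounded operator `g(V)` given by the measurable functional calculus of the self-adjoint
operator `V`, for a Borel function `g` that is essentially bounded with respect to the spectral
measure of `V`. (Junk value `0` if there is no such operator.) -/
noncomputable def borelCalculus (V : H →ₗ.[ℂ] H) (g : ℝ → ℂ) : H →L[ℂ] H :=
  if h : ∃ B, IsBorelCalculus V g B then h.choose else 0

end FunctionalCalculus

/-! ### The weighted space, the infinitesimal shift and the momentum operator -/

/-- The measure `e^{-2ct} dt` on `ℝ`. -/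
noncomputable def weight (c : ℝ) : Measure ℝ :=
  volume.withDensity (fun t => ENNReal.ofReal (Real.exp (-2 * c * t)))

/-- The Hilbert space `ℍ_c = L²(ℝ, e^{-2ct} dt)` of complex-valued functions. -/
abbrev HSpace (c : ℝ) : Type := Lp ℂ 2 (weight c)

theorem volume_ac_weight (c : ℝ) : volume ≪ weight c :=
  withDensity_absolutelyContinuous' (by fun_prop)
    (ae_of_all _ fun t => by simp [Real.exp_pos])

/-- The graph of the infinitesimal shift: the pairs `(f, f')` with `f, f' ∈ ℍ_c` and `f` (having a
representative `u` that is) locally absolutely continuous on `ℝ`. -/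
noncomputable def shiftGraph (c : ℝ) : Submodule ℂ (HSpace c × HSpace c) where
  carrier := {p | ∃ u : ℝ → ℂ, (∀ a b : ℝ, AbsolutelyContinuousOnInterval u a b) ∧
    (p.1 : ℝ → ℂ) =ᵐ[weight c] u ∧ ∀ᵐ t ∂(weight c), HasDerivAt u ((p.2 : ℝ → ℂ) t) t}
  zero_mem' := by
    refine ⟨0, fun a b => ?_, Lp.coeFn_zero _ _ _, ?_⟩
    · exact (contDiff_const (c := (0 : ℂ)) (n := 1)).contDiffOn.absolutelyContinuousOnInterval
    · filter_upwards [Lp.coeFn_zero ℂ 2 (weight c)] with t ht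
      have : (((0 : HSpace c × HSpace c).2 : HSpace c) : ℝ → ℂ) t = 0 := ht
      rw [this]
      exact hasDerivAt_const t 0
  add_mem' := by
    rintro p q ⟨u, hu, hpu, hu'⟩ ⟨v, hv, hqv, hv'⟩
    refine ⟨u + v, fun a b => (hu a b).add (hv a b), ?_, ?_⟩
    · exact (Lp.coeFn_add p.1 q.1).trans (hpu.add hqv)
    · filter_upwards [hu', hv', Lp.coeFn_add p.2 q.2] with t h1 h2 h3
      have : (((p + q).2 : HSpace c) : ℝ → ℂ) t = (p.2 : ℝ → ℂ) t + (q.2 : ℝ → ℂ) t := h3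
      rw [this]
      exact h1.add h2
  smul_mem' := by
    rintro k p ⟨u, hu, hpu, hu'⟩
    refine ⟨k • u, fun a b => (hu a b).const_smul k, ?_, ?_⟩
    · exact (Lp.coeFn_smul k p.1).trans (hpu.const_smul k)
    · filter_upwards [hu', Lp.coeFn_smul k p.2] with t h1 h3
      have : (((k • p).2 : HSpace c) : ℝ → ℂ) t = k • (p.2 : ℝ → ℂ) t := h3
      rw [this]
      exact h1.const_smul k

/-- The relation `shiftGraph c` is indeed the graph of an operator. -/
theorem shiftGraph_functional (c : ℝ) (p : HSpace c × HSpace c) (hp : p ∈ shiftGraph c)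
    (h0 : p.1 = 0) : p.2 = 0 := by
  obtain ⟨u, hu, hpu, hu'⟩ := hp
  have hcont : Continuous u := by
    rw [continuous_iff_continuousAt]
    intro t
    refine (hu (t - 1) (t + 1)).continuousOn.continuousAt ?_
    rw [Set.uIcc_of_le (by linarith)]
    exact Icc_mem_nhds (by linarith) (by linarith)
  have hz : u =ᵐ[volume] fun _ => (0 : ℂ) := by
    refine (volume_ac_weight c).ae_le ?_
    have h1 : ((0 : HSpace c) : ℝ → ℂ) =ᵐ[weight c] 0 := Lp.coeFn_zero _ _ _
    rw [h0] at hpu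
    filter_upwards [hpu, h1] with t h2 h3
    rw [← h2, h3]
    rfl
  have hu0 : u = fun _ => (0 : ℂ) := hcont.ae_eq_iff_eq volume continuous_const |>.1 hz
  apply Lp.ext
  filter_upwards [hu', Lp.coeFn_zero ℂ 2 (weight c)] with t h1 h2
  rw [h2, hu0] at *
  exact h1.unique (hasDerivAt_const t 0)

/-- The infinitesimal shift `∂_c f = f'` on `ℍ_c`, with domain
`{f ∈ ℍ_c ∩ AC(ℝ) : f' ∈ ℍ_c}`. -/
noncomputable def infinitesimalShift (c : ℝ) : HSpace c →ₗ.[ℂ] HSpace c :=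
  (shiftGraph c).toLinearPMap

/-- The `c`-momentum operator `V_c = (∂_c - c) / i`, with the domain of `∂_c`. -/
noncomputable def momentum (c : ℝ) : HSpace c →ₗ.[ℂ] HSpace c :=
  Complex.I⁻¹ • ((-((c : ℂ) • (LinearMap.id : HSpace c →ₗ[ℂ] HSpace c))) +ᵥ infinitesimalShift c)

/-! ### Truncations and almost invertibility -/

/-- The essential range, with respect to Lebesgue measure, of a function `φ : ℝ → ℝ`. -/
def essRange (φ : ℝ → ℝ) : Set ℝ :=
  {y | ∀ U ∈ 𝓝 y, 0 < volume (φ ⁻¹' U)}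

/-- For a continuous function, the essential range is the closure of the range. -/
theorem essRange_eq_closure_range {φ : ℝ → ℝ} (hφ : Continuous φ) :
    essRange φ = closure (Set.range φ) := by
  ext y
  rw [mem_closure_iff_nhds]
  constructor
  · intro h U hU
    obtain ⟨x, hx⟩ := nonempty_of_measure_ne_zero (h U hU).ne'
    exact ⟨φ x, hx, x, rfl⟩
  · intro h U hU
    obtain ⟨_, hz, x, rfl⟩ := h (interior U) (interior_mem_nhds.2 hU)
    exact ((isOpen_interior.preimage hφ).measure_pos volume ⟨x, hz⟩).trans_le
      (measure_mono (Set.preimage_mono interior_subset))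

/-- A `(T₀, T)`-admissible cut-off function: a Borel function whose essential range (for a
continuous function: the closure of the range) is `{τ : T₀ ≤ |τ| ≤ T}`. Continuity itself cannot be
asked for, since `{τ : T₀ ≤ |τ| ≤ T}` is disconnected for `T₀ > 0`. -/
def IsAdmissibleCutoff (T₀ T : ℝ) (φ : ℝ → ℝ) : Prop :=
  Measurable φ ∧ essRange φ = {τ : ℝ | T₀ ≤ |τ| ∧ |τ| ≤ T}

/-- Admissible cut-off functions exist. -/
theorem exists_isAdmissibleCutoff {T₀ T : ℝ} (h0 : 0 ≤ T₀) (hT : T₀ < T) :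
    ∃ φ : ℝ → ℝ, IsAdmissibleCutoff T₀ T φ := by
  classical
  set S : Set ℝ := {τ : ℝ | T₀ ≤ |τ| ∧ |τ| ≤ T} with hS
  have hSc : IsClosed S :=
    (isClosed_le continuous_const continuous_abs).inter
      (isClosed_le continuous_abs continuous_const)
  have hTS : T ∈ S := by
    have : |T| = T := abs_of_pos (by linarith)
    exact ⟨by rw [this]; exact hT.le, this.le⟩
  refine ⟨fun t => if t ∈ S then t else T,
    Measurable.ite hSc.measurableSet measurable_id measurable_const, ?_⟩
  ext y
  constructor
  · intro h
    by_contra hy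
    have := h Sᶜ (hSc.isOpen_compl.mem_nhds hy)
    obtain ⟨x, hx⟩ := nonempty_of_measure_ne_zero this.ne'
    by_cases hxS : x ∈ S <;> simp [hxS, hTS] at hx
  · rintro hy U hU
    obtain ⟨e, he, hball⟩ := Metric.mem_nhds_iff.1 hU
    have key : ∃ a b : ℝ, a < b ∧ Set.Ioo a b ⊆ S ∩ Metric.ball y e := by
      rcases le_or_gt 0 y with hy0 | hy0
      · obtain ⟨h1, h2⟩ := hy
        rw [abs_of_nonneg hy0] at h1 h2
        refine ⟨max T₀ (y - e), min T (y + e), ?_, ?_⟩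
        · simp only [max_lt_iff, lt_min_iff]
          exact ⟨⟨hT, by linarith⟩, by linarith, by linarith⟩
        · rintro t ⟨ha, hb⟩
          rw [max_lt_iff] at ha
          rw [lt_min_iff] at hb
          have : |t| = t := abs_of_nonneg (by linarith)
          refine ⟨⟨by rw [this]; linarith, by rw [this]; linarith⟩, ?_⟩
          rw [Metric.mem_ball, Real.dist_eq, abs_lt]
          constructor <;> linarith
      · obtain ⟨h1, h2⟩ := hy
        rw [abs_of_neg hy0] at h1 h2
        refine ⟨max (-T) (y - e), min (-T₀) (y + e), ?_, ?_⟩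
        · simp only [max_lt_iff, lt_min_iff]
          exact ⟨⟨by linarith, by linarith⟩, by linarith, by linarith⟩
        · rintro t ⟨ha, hb⟩
          rw [max_lt_iff] at ha
          rw [lt_min_iff] at hb
          have : |t| = -t := abs_of_nonpos (by linarith)
          refine ⟨⟨by rw [this]; linarith, by rw [this]; linarith⟩, ?_⟩
          rw [Metric.mem_ball, Real.dist_eq, abs_lt]
          constructor <;> linarith
    obtain ⟨a, b, hab, hsub⟩ := key
    refine (isOpen_Ioo.measure_pos volume (Set.nonempty_Ioo.2 hab)).trans_le (measure_mono ?_)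
    intro t ht
    have := hsub ht
    simp only [Set.mem_preimage, if_pos this.1]
    exact hball this.2

/-- The truncated infinitesimal shift `c + i φ(V_c)` for the cut-off function `φ`. -/
noncomputable def truncatedShift (c : ℝ) (φ : ℝ → ℝ) : HSpace c →L[ℂ] HSpace c :=
  (c : ℂ) • 1 + Complex.I • borelCalculus (momentum c) (fun t => (φ t : ℂ))

/-- The truncated spectral operator `ζ(c + i φ(V_c))`, through the continuous functional calculus of
the bounded normal operator `c + i φ(V_c)` (`ζ` is continuous on its spectrum when `c ≠ 1`). -/
noncomputable def truncatedSpectralOperator (c : ℝ) (φ : ℝ → ℝ) : HSpace c →L[ℂ] HSpace c :=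
  cfc riemannZeta (truncatedShift c φ)

/-- Almost invertibility of the spectral operator `𝔞_c`, where `φ T₀ T` is the cut-off function used
for the `(T₀, T)`-truncation: for some `T₀ ≥ 0`, the truncations of `𝔞_c` are invertible (with
bounded inverse) for all `T > T₀`. -/
def AlmostInvertible (c : ℝ) (φ : ℝ → ℝ → ℝ → ℝ) : Prop :=
  ∃ T₀ : ℝ, 0 ≤ T₀ ∧ ∀ T : ℝ, T₀ < T → IsUnit (truncatedSpectralOperator c (φ T₀ T))

/-- The almost Riemann hypothesis: on every vertical line `Re s = c` with `c > 1/2` there are at most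
finitely many zeros of the Riemann zeta function. -/
def AlmostRH : Prop :=
  ∀ c : ℝ, 1 / 2 < c → {s : ℂ | s.re = c ∧ riemannZeta s = 0}.Finite

end SpectralOp

/-! The momentum operator is diagonalized explicitly. Multiplication by `e^{-ct}` is a unitary from
`ℍ_c` onto `L²(ℝ)` that turns `∂_c` into `d/dt + c`, so `V_c` becomes `(1/i) d/dt`, and the Fourier
transform turns this into multiplication by `2πξ` with maximal domain (`isMulModel_momentum`). Hence
`c + iφ(V_c)` is multiplication by `c + iφ(2πξ)`, and its spectrum is `c + i · essRange φ`, here the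
two (possibly joined) segments `T₀ ≤ |Im z| ≤ T` of the line `Re z = c`. By spectral mapping for
`cfc`, the truncated spectral operator is invertible iff `ζ` has no zero on these segments
(`isUnit_truncatedSpectralOperator_iff`). Almost invertibility therefore says that the zeros on the
line have bounded height. Since a compact set contains finitely many zeros, this is finiteness on
the line. Lines with `c ≥ 1` carry no zeros.

The delicate point is that `borelCalculus` chooses an operator coming from some resolution of the
identity `E` of `V`, about which only the domain and the quadratic form are known. So the scalar
spectral measures must be shown to be unique (`IsMulModel.measure_eq`). On the range of `E(I)`, with
`I` of centre `c` and radius `r`, one has `‖(V - c)x‖ ≤ r‖x‖`. Iterating this shows that `Ux` lives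
on `m⁻¹(I)`. Thus the measure given by `E` is at most the model measure on every compact interval,
and equal total mass together with absence of atoms forces equality. -/

namespace SpectralOp

/-! ### Multiplication operators on `L²` -/

section Multiplication

variable {X : Type*} [MeasurableSpace X] {ν : Measure X}

open Classical in
variable (ν) in
/-- Multiplication by an essentially bounded function `g` on `L²(ν)`. (Junk value `0` if `g` is not
essentially bounded.) -/
noncomputable def mulOp (g : X → ℂ) : Lp ℂ 2 ν →L[ℂ] Lp ℂ 2 ν :=
  if h : MemLp g ⊤ ν then (ContinuousLinearMap.mul ℂ ℂ).holderL ν ⊤ 2 2 (h.toLp g) else 0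

theorem coeFn_mulOp {g : X → ℂ} (hg : MemLp g ⊤ ν) (f : Lp ℂ 2 ν) :
    mulOp ν g f =ᵐ[ν] fun x => g x * f x := by
  rw [mulOp, dif_pos hg]
  filter_upwards [(ContinuousLinearMap.mul ℂ ℂ).coeFn_holder (r := 2) (hg.toLp g) f,
    hg.coeFn_toLp] with x h1 h2
  rw [← h2]
  exact h1

theorem mulOp_congr {g g' : X → ℂ} (h : g =ᵐ[ν] g') : mulOp ν g = mulOp ν g' := by
  by_cases hg : MemLp g ⊤ ν
  · have hg' := hg.ae_eq h
    ext1 f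
    apply Lp.ext
    filter_upwards [coeFn_mulOp hg f, coeFn_mulOp hg' f, h] with x h1 h2 h3
    rw [h1, h2, h3]
  · have hg' : ¬ MemLp g' ⊤ ν := fun h' => hg (h'.ae_eq h.symm)
    rw [mulOp, mulOp, dif_neg hg, dif_neg hg']

theorem mulOp_mul {g g' : X → ℂ} (hg : MemLp g ⊤ ν) (hg' : MemLp g' ⊤ ν) :
    mulOp ν (fun x => g x * g' x) = mulOp ν g * mulOp ν g' := by
  have hgg : MemLp (fun x => g x * g' x) ⊤ ν := hg'.mul' hg
  ext1 f
  apply Lp.ext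
  rw [mul_apply_eq_comp]
  filter_upwards [coeFn_mulOp hgg f, coeFn_mulOp hg (mulOp ν g' f), coeFn_mulOp hg' f]
    with x h1 h2 h3
  rw [h1, h2, h3, mul_assoc]

theorem mulOp_const (c : ℂ) : mulOp ν (fun _ => c) = c • (1 : Lp ℂ 2 ν →L[ℂ] Lp ℂ 2 ν) := by
  ext1 f
  apply Lp.ext
  have hc : MemLp (fun _ : X => c) ⊤ ν := memLp_top_const c
  filter_upwards [coeFn_mulOp hc f, Lp.coeFn_smul c f] with x h1 h2
  rw [h1]
  exact h2.symm

theorem mulOp_add {g g' : X → ℂ} (hg : MemLp g ⊤ ν) (hg' : MemLp g' ⊤ ν) :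
    mulOp ν (fun x => g x + g' x) = mulOp ν g + mulOp ν g' := by
  have hgg : MemLp (fun x => g x + g' x) ⊤ ν := hg.add hg'
  ext1 f
  apply Lp.ext
  filter_upwards [coeFn_mulOp hgg f, Lp.coeFn_add (mulOp ν g f) (mulOp ν g' f),
    coeFn_mulOp hg f, coeFn_mulOp hg' f] with x h1 h2 h3 h4
  rw [h1, add_mul, ← h3, ← h4]
  exact h2.symm

theorem mulOp_sub {g g' : X → ℂ} (hg : MemLp g ⊤ ν) (hg' : MemLp g' ⊤ ν) :
    mulOp ν (fun x => g x - g' x) = mulOp ν g - mulOp ν g' := by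
  have h := mulOp_add (hg.sub hg') hg'
  rw [eq_sub_iff_add_eq]
  refine h.symm.trans ?_
  simp

theorem inner_mulOp {g : X → ℂ} (hg : MemLp g ⊤ ν) (f f' : Lp ℂ 2 ν) :
    inner ℂ f (mulOp ν g f') = ∫ x, g x * inner ℂ (f x) (f' x) ∂ν := by
  rw [L2.inner_def]
  refine integral_congr_ae ?_
  filter_upwards [coeFn_mulOp hg f'] with x hx
  rw [hx]
  simp only [RCLike.inner_apply]
  ring

theorem adjoint_mulOp {g : X → ℂ} (hg : MemLp g ⊤ ν) :
    star (mulOp ν g) = mulOp ν (fun x => (starRingEnd ℂ) (g x)) := by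
  have hg' : MemLp (fun x => (starRingEnd ℂ) (g x)) ⊤ ν := hg.star
  rw [ContinuousLinearMap.star_eq_adjoint, eq_comm, ContinuousLinearMap.eq_adjoint_iff]
  intro f f'
  rw [inner_mulOp hg, L2.inner_def]
  refine integral_congr_ae ?_
  filter_upwards [coeFn_mulOp hg' f] with x hx
  rw [hx]
  simp only [RCLike.inner_apply, map_mul, RingHomCompTriple.comp_apply, RingHom.id_apply]
  ring

theorem isStarNormal_mulOp {g : X → ℂ} (hg : MemLp g ⊤ ν) : IsStarNormal (mulOp ν g) := by
  have hg' : MemLp (fun x => (starRingEnd ℂ) (g x)) ⊤ ν := hg.star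
  refine ⟨?_⟩
  rw [adjoint_mulOp hg, Commute, SemiconjBy, ← mulOp_mul hg hg', ← mulOp_mul hg' hg]
  simp_rw [mul_comm]

theorem isUnit_mulOp {g : X → ℂ} (hg : MemLp g ⊤ ν) {ε : ℝ} (hε : 0 < ε)
    (h : ∀ᵐ x ∂ν, ε ≤ ‖g x‖) : IsUnit (mulOp ν g) := by
  have hm : MemLp (fun x => (g x)⁻¹) ⊤ ν := by
    refine memLp_top_of_bound (C := ε⁻¹) hg.1.inv₀ ?_
    filter_upwards [h] with x hx
    rw [norm_inv]
    exact inv_anti₀ hε hx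
  have h1 : (fun x => g x * (g x)⁻¹) =ᵐ[ν] fun _ => (1 : ℂ) := by
    filter_upwards [h] with x hx
    exact mul_inv_cancel₀ (norm_pos_iff.1 (hε.trans_le hx))
  have h2 : mulOp ν g * mulOp ν (fun x => (g x)⁻¹) = 1 := by
    rw [← mulOp_mul hg hm, mulOp_congr h1, mulOp_const, one_smul]
  have h3 : mulOp ν (fun x => (g x)⁻¹) * mulOp ν g = 1 := by
    rw [← h2, ← mulOp_mul hg hm, ← mulOp_mul hm hg]
    simp_rw [mul_comm]
  exact ⟨⟨_, _, h2, h3⟩, rfl⟩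

theorem norm_mulOp_le_of_forall {g : X → ℂ} (hg : MemLp g ⊤ ν) (f : Lp ℂ 2 ν) {ε : ℝ}
    (h : ∀ᵐ x ∂ν, f x ≠ 0 → ‖g x‖ ≤ ε) : ‖mulOp ν g f‖ ≤ ε * ‖f‖ := by
  refine Lp.norm_le_mul_norm_of_ae_le_mul ?_
  filter_upwards [coeFn_mulOp hg f, h] with x h1 h2
  rw [h1, norm_mul]
  by_cases h0 : f x = 0
  · simp [h0]
  · exact mul_le_mul_of_nonneg_right (h2 h0) (norm_nonneg _)

/-- The indicator of a set of finite positive measure on which `|g| < ε` is an approximate null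
vector. Sigma-finiteness provides such a set inside `{|g| < ε}`. -/
theorem not_isUnit_mulOp [SigmaFinite ν] {g : X → ℂ} (hg : MemLp g ⊤ ν) (hgm : Measurable g)
    (h : ∀ ε > 0, 0 < ν {x | ‖g x‖ < ε}) : ¬ IsUnit (mulOp ν g) := by
  rintro ⟨u, hu⟩
  set B : Lp ℂ 2 ν →L[ℂ] Lp ℂ 2 ν := ↑u⁻¹ with hB
  have hBu : B * mulOp ν g = 1 := by rw [← hu]; exact u.inv_mul
  -- Chosen so that `‖B‖ * ε < 1`, which contradicts `‖f‖ ≤ ‖B‖ * ε * ‖f‖`.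
  set ε : ℝ := (2 * (‖B‖ + 1))⁻¹ with hε
  have hB0 : 0 ≤ ‖B‖ := norm_nonneg _
  have hε0 : 0 < ε := by positivity
  have hms : MeasurableSet {x | ‖g x‖ < ε} := measurableSet_lt hgm.norm measurable_const
  obtain ⟨t, htm, hts, ht0, htt⟩ := Measure.exists_subset_measure_lt_top hms (h ε hε0)
  set f : Lp ℂ 2 ν := indicatorConstLp 2 htm htt.ne (1 : ℂ) with hf
  have hfn : 0 < ‖f‖ := by
    rw [norm_pos_iff]
    intro h0
    have h1 := norm_indicatorConstLp (p := 2) (hs := htm) (hμs := htt.ne) (c := (1 : ℂ))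
      (by norm_num) (by norm_num)
    rw [← hf, h0, norm_zero, norm_one, one_mul, eq_comm,
      Real.rpow_eq_zero measureReal_nonneg (by norm_num)] at h1
    exact ht0.ne' ((measureReal_eq_zero_iff htt.ne).1 h1)
  have h1 : ‖mulOp ν g f‖ ≤ ε * ‖f‖ := by
    refine norm_mulOp_le_of_forall hg f ?_
    filter_upwards [indicatorConstLp_coeFn (p := 2) (hs := htm) (hμs := htt.ne) (c := (1 : ℂ))]
      with x hx hx0
    have : x ∈ t := by
      by_contra hxt
      rw [hf, hx, Set.indicator_of_notMem hxt] at hx0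
      exact hx0 rfl
    exact (hts this).le
  have h2 : f = B (mulOp ν g f) := by
    have := congrArg (fun A : Lp ℂ 2 ν →L[ℂ] Lp ℂ 2 ν => A f) hBu
    simpa using this.symm
  have h3 : ‖f‖ ≤ ‖B‖ * (ε * ‖f‖) := by
    calc ‖f‖ = ‖B (mulOp ν g f)‖ := by rw [← h2]
      _ ≤ ‖B‖ * ‖mulOp ν g f‖ := B.le_opNorm _
      _ ≤ _ := by gcongr
  have h4 : ‖B‖ * ε < 1 := by
    rw [hε, ← div_eq_mul_inv, div_lt_one (by positivity)]
    linarith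
  nlinarith

theorem mem_spectrum_mulOp_iff [SigmaFinite ν] {g : X → ℂ} (hg : MemLp g ⊤ ν) (hgm : Measurable g)
    (z : ℂ) : z ∈ spectrum ℂ (mulOp ν g) ↔ ∀ ε > 0, 0 < ν {x | ‖z - g x‖ < ε} := by
  have hz : MemLp (fun _ : X => z) ⊤ ν := memLp_top_const z
  have hzg : MemLp (fun x => z - g x) ⊤ ν := hz.sub hg
  have heq : algebraMap ℂ (Lp ℂ 2 ν →L[ℂ] Lp ℂ 2 ν) z - mulOp ν g =
      mulOp ν (fun x => z - g x) := by
    rw [mulOp_sub hz hg, mulOp_const, Algebra.algebraMap_eq_smul_one]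
  rw [spectrum.mem_iff, heq]
  constructor
  · intro h
    by_contra! hne
    obtain ⟨ε, hε, h0⟩ := hne
    refine h (isUnit_mulOp hzg hε ?_)
    rw [ae_iff]
    simpa using h0
  · exact not_isUnit_mulOp hzg (measurable_const.sub hgm)

end Multiplication

/-! ### The projection-valued measure of a multiplication operator -/

section MultiplicationMeasure

variable {X : Type*} [MeasurableSpace X] {ν : Measure X}

theorem ofReal_norm_sq_eq_lintegral (f : Lp ℂ 2 ν) :
    ENNReal.ofReal (‖f‖ ^ 2) = ∫⁻ x, ‖f x‖ₑ ^ 2 ∂ν := by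
  rw [Lp.norm_def, ← ENNReal.toReal_pow, ENNReal.ofReal_toReal (by simp [Lp.eLpNorm_ne_top]),
    eLpNorm_eq_lintegral_rpow_enorm_toReal (by norm_num) (by norm_num)]
  simp only [ENNReal.toReal_ofNat, ENNReal.rpow_ofNat, one_div]
  rw [← ENNReal.rpow_natCast, ← ENNReal.rpow_mul]
  simp

theorem memLp_indicator_one {A : Set X} (hA : MeasurableSet A) :
    MemLp (A.indicator fun _ => (1 : ℂ)) ⊤ ν :=
  (memLp_top_const 1).indicator hA

theorem ofReal_norm_sq_mulOp_indicator {A : Set X} (hA : MeasurableSet A) (f : Lp ℂ 2 ν) :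
    ENNReal.ofReal (‖mulOp ν (A.indicator fun _ => (1 : ℂ)) f‖ ^ 2) =
      ∫⁻ x in A, ‖f x‖ₑ ^ 2 ∂ν := by
  rw [ofReal_norm_sq_eq_lintegral, ← lintegral_indicator hA]
  refine lintegral_congr_ae ?_
  filter_upwards [coeFn_mulOp (memLp_indicator_one hA) f] with x hx
  rw [hx]
  by_cases hxA : x ∈ A <;> simp [hxA]

/-- The measure `|f|² ν`, for `f ∈ L²(ν)`. -/
noncomputable def sqDensity (f : Lp ℂ 2 ν) : Measure X :=
  ν.withDensity fun x => ‖f x‖ₑ ^ 2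

theorem sqDensity_apply (f : Lp ℂ 2 ν) {A : Set X} (hA : MeasurableSet A) :
    sqDensity f A = ENNReal.ofReal (‖mulOp ν (A.indicator fun _ => (1 : ℂ)) f‖ ^ 2) := by
  rw [sqDensity, withDensity_apply _ hA, ofReal_norm_sq_mulOp_indicator hA]

instance isFiniteMeasure_sqDensity (f : Lp ℂ 2 ν) : IsFiniteMeasure (sqDensity f) := by
  refine ⟨?_⟩
  rw [sqDensity_apply f MeasurableSet.univ]
  exact ENNReal.ofReal_lt_top

theorem sum_mulOp_indicator {s : ℕ → Set X} (hs : ∀ n, MeasurableSet (s n))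
    (hd : Pairwise (Function.onFun Disjoint s)) (F : Finset ℕ) :
    ∑ n ∈ F, mulOp ν ((s n).indicator fun _ => (1 : ℂ)) =
      mulOp ν ((⋃ n ∈ F, s n).indicator fun _ => (1 : ℂ)) := by
  classical
  induction F using Finset.induction_on with
  | empty =>
    have := mulOp_const (ν := ν) 0
    simpa using this.symm
  | insert a F ha ih =>
    rw [Finset.sum_insert ha, ih, ← mulOp_add (memLp_indicator_one (hs a))
      (memLp_indicator_one (F.measurableSet_biUnion fun n _ => hs n)), Finset.set_biUnion_insert]
    congr 1
    have hdis : Disjoint (s a) (⋃ n ∈ F, s n) := by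
      rw [Set.disjoint_iUnion₂_right]
      intro n hn
      exact hd (by rintro rfl; exact ha hn)
    rw [Set.indicator_union_of_disjoint hdis]

/-- The squared norm of the remainder is the mass that the finite measure `|f|² ν` gives to the sets
not yet summed, and this tends to zero by countable additivity. -/
theorem hasSum_mulOp_indicator {s : ℕ → Set X} (hs : ∀ n, MeasurableSet (s n))
    (hd : Pairwise (Function.onFun Disjoint s)) (f : Lp ℂ 2 ν) :
    HasSum (fun n => mulOp ν ((s n).indicator fun _ => (1 : ℂ)) f)
      (mulOp ν ((⋃ n, s n).indicator fun _ => (1 : ℂ)) f) := by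
  rw [HasSum, SummationFilter.unconditional_filter]
  have key : ∀ F : Finset ℕ,
      ENNReal.ofReal (‖∑ n ∈ F, mulOp ν ((s n).indicator fun _ => (1 : ℂ)) f -
        mulOp ν ((⋃ n, s n).indicator fun _ => (1 : ℂ)) f‖ ^ 2) =
      sqDensity f (⋃ n, s n) - ∑ n ∈ F, sqDensity f (s n) := by
    intro F
    have hF : MeasurableSet (⋃ n ∈ F, s n) := F.measurableSet_biUnion fun n _ => hs n
    have hsub : (⋃ n ∈ F, s n) ⊆ ⋃ n, s n := Set.iUnion₂_subset_iUnion _ _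
    rw [← measure_biUnion_finset (fun i _ j _ hij => hd hij) (fun n _ => hs n),
      ← measure_sdiff hsub hF.nullMeasurableSet (measure_ne_top _ _),
      sqDensity_apply f ((MeasurableSet.iUnion hs).diff hF), norm_sub_rev]
    have h1 := congrArg (fun A : Lp ℂ 2 ν →L[ℂ] Lp ℂ 2 ν => A f) (sum_mulOp_indicator hs hd F)
    simp only [_root_.sum_apply] at h1
    rw [h1, ← _root_.sub_apply, ← mulOp_sub
      (memLp_indicator_one (MeasurableSet.iUnion hs)) (memLp_indicator_one hF)]
    congr 6
    rw [Set.indicator_sdiff hsub]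
    rfl
  have hsum : Tendsto (fun F : Finset ℕ => sqDensity f (⋃ n, s n) - ∑ n ∈ F, sqDensity f (s n))
      atTop (𝓝 0) := by
    have h1 : HasSum (fun n => sqDensity f (s n)) (sqDensity f (⋃ n, s n)) := by
      rw [measure_iUnion hd hs]
      exact ENNReal.summable.hasSum
    rw [HasSum, SummationFilter.unconditional_filter] at h1
    have h2 := ENNReal.Tendsto.sub (tendsto_const_nhds (x := sqDensity f (⋃ n, s n))) h1
      (Or.inl (measure_ne_top _ _))
    rwa [tsub_self] at h2
  rw [tendsto_iff_norm_sub_tendsto_zero]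
  have h3 := (ENNReal.tendsto_toReal ENNReal.zero_ne_top).comp hsum
  have h4 : Tendsto (fun F : Finset ℕ =>
      ‖∑ n ∈ F, mulOp ν ((s n).indicator fun _ => (1 : ℂ)) f -
        mulOp ν ((⋃ n, s n).indicator fun _ => (1 : ℂ)) f‖ ^ 2) atTop (𝓝 0) := by
    refine h3.congr fun F => ?_
    simp only [Function.comp]
    rw [← key F, ENNReal.toReal_ofReal (by positivity)]
  have h5 := h4.sqrt
  simpa using h5

variable {H : Type*} [NormedAddCommGroup H] [InnerProductSpace ℂ H] [CompleteSpace H]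

/-- The resolution of the identity `s ↦ U⁻¹ 1_{m⁻¹ s} U`, where `U` is a unitary onto `L²(ν)`. -/
noncomputable def mulPVM (U : H ≃ₗᵢ[ℂ] Lp ℂ 2 ν) (m : X → ℝ) (hm : Measurable m) :
    ProjectionValuedMeasure H where
  proj s := U.conjStarAlgEquiv.symm (mulOp ν ((m ⁻¹' s).indicator fun _ => (1 : ℂ)))
  isStarProjection s hs := by
    refine IsStarProjection.map ⟨?_, ?_⟩ U.conjStarAlgEquiv.symm
    · rw [IsIdempotentElem, ← mulOp_mul (memLp_indicator_one (hm hs)) (memLp_indicator_one (hm hs))]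
      congr 1
      ext x
      by_cases hx : x ∈ m ⁻¹' s <;> simp [hx]
    · rw [IsSelfAdjoint, adjoint_mulOp (memLp_indicator_one (hm hs))]
      congr 1
      ext x
      by_cases hx : x ∈ m ⁻¹' s <;> simp [hx]
  proj_univ := by
    have := mulOp_const (ν := ν) 1
    simp [this]
  proj_inter s t hs ht := by
    rw [← map_mul, ← mulOp_mul (memLp_indicator_one (hm hs)) (memLp_indicator_one (hm ht))]
    congr 2
    ext x
    by_cases hx : x ∈ m ⁻¹' s <;> by_cases hx' : x ∈ m ⁻¹' t <;> simp_all
  hasSum_iUnion s hs hd x := by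
    have h := (hasSum_mulOp_indicator (ν := ν) (fun n => hm (hs n))
      (fun i j hij => (hd hij).preimage m) (U x)).mapL
        (U.symm.toContinuousLinearEquiv : Lp ℂ 2 ν →L[ℂ] H)
    rw [← Set.preimage_iUnion] at h
    exact h

theorem mulPVM_measure (U : H ≃ₗᵢ[ℂ] Lp ℂ 2 ν) {m : X → ℝ} (hm : Measurable m) (x : H) :
    (mulPVM U m hm).measure x = (sqDensity (U x)).map m := by
  ext s hs
  rw [ProjectionValuedMeasure.measure, Measure.ofMeasurable_apply s hs, Measure.map_apply hm hs,
    sqDensity_apply _ (hm hs)]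
  congr 2
  change ‖U.symm (mulOp ν _ (U x))‖ = _
  rw [LinearIsometryEquiv.norm_map]

theorem integral_sqDensity (f : Lp ℂ 2 ν) (g : X → ℂ) :
    ∫ x, g x ∂(sqDensity f) = ∫ x, g x * inner ℂ (f x) (f x) ∂ν := by
  have hf : AEMeasurable (fun x => ‖f x‖₊ ^ 2) ν := by
    have := (Lp.aestronglyMeasurable f).aemeasurable
    fun_prop
  have : sqDensity f = ν.withDensity fun x => ((‖f x‖₊ ^ 2 : NNReal) : ENNReal) := by
    simp only [sqDensity, ENNReal.coe_pow]
    rfl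
  rw [this, integral_withDensity_eq_integral_smul₀ hf]
  refine integral_congr_ae (ae_of_all _ fun x => ?_)
  simp only [NNReal.smul_def, inner_self_eq_norm_sq_to_K]
  simp [mul_comm]

theorem integrable_sqDensity_iff (f : Lp ℂ 2 ν) {E : Type*} [NormedAddCommGroup E]
    [NormedSpace ℝ E] (g : X → E) :
    Integrable g (sqDensity f) ↔ Integrable (fun x => (‖f x‖ ^ 2) • g x) ν := by
  have hf : AEMeasurable (fun x => ‖f x‖₊ ^ 2) ν := by
    have := (Lp.aestronglyMeasurable f).aemeasurable
    fun_prop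
  have : sqDensity f = ν.withDensity fun x => ((‖f x‖₊ ^ 2 : NNReal) : ENNReal) := by
    simp only [sqDensity, ENNReal.coe_pow]
    rfl
  rw [this, integrable_withDensity_iff_integrable_smul₀ hf]
  simp [NNReal.smul_def]

theorem sqDensity_absolutelyContinuous (f : Lp ℂ 2 ν) : sqDensity f ≪ ν :=
  withDensity_absolutelyContinuous _ _

end MultiplicationMeasure

/-! ### Absolutely continuous functions on the line -/

section AbsolutelyContinuousFunctions

theorem absolutelyContinuousOnInterval_ofReal {f : ℝ → ℝ} {a b : ℝ}
    (hf : AbsolutelyContinuousOnInterval f a b) :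
    AbsolutelyContinuousOnInterval (fun x => (f x : ℂ)) a b := by
  rw [absolutelyContinuousOnInterval_iff] at hf ⊢
  simpa [Complex.isometry_ofReal.dist_eq] using hf

/-- The real-valued result is applied to real and imaginary parts, on an interval enlarged to
contain the base point `c`. -/
theorem absolutelyContinuousOnInterval_integral {h : ℝ → ℂ} (hh : LocallyIntegrable h)
    (c a b : ℝ) : AbsolutelyContinuousOnInterval (fun x => ∫ t in c..x, h t) a b := by
  set p := min c (min a b)
  set q := max c (max a b)
  have hpq : p ≤ q := (min_le_left _ _).trans (le_max_left _ _)
  have hi : ∀ x y : ℝ, IntervalIntegrable h volume x y := fun x y =>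
    (hh.integrableOn_isCompact isCompact_uIcc).intervalIntegrable
  have hc : c ∈ Set.uIcc p q := by
    rw [Set.uIcc_of_le hpq]
    exact ⟨min_le_left _ _, le_max_left _ _⟩
  have h1 : IntervalIntegrable (fun t => (h t).re) volume p q := ⟨(hi p q).1.re, (hi p q).2.re⟩
  have h2 : IntervalIntegrable (fun t => (h t).im) volume p q := ⟨(hi p q).1.im, (hi p q).2.im⟩
  have h3 := (absolutelyContinuousOnInterval_ofReal
    (h1.absolutelyContinuousOnInterval_intervalIntegral hc)).add
    ((absolutelyContinuousOnInterval_ofReal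
      (h2.absolutelyContinuousOnInterval_intervalIntegral hc)).const_smul Complex.I)
  have h4 : (fun x => ∫ t in c..x, h t) = (fun x => ((∫ t in c..x, (h t).re : ℝ) : ℂ)) +
      fun x => Complex.I • ((∫ t in c..x, (h t).im : ℝ) : ℂ) := by
    ext x
    simp only [Pi.add_apply, smul_eq_mul]
    rw [← intervalIntegral.integral_ofReal, ← intervalIntegral.integral_ofReal,
      ← intervalIntegral.integral_const_mul, ← intervalIntegral.integral_add]
    · refine intervalIntegral.integral_congr fun t _ => ?_
      simp [mul_comm Complex.I, Complex.re_add_im]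
    · exact ⟨(hi c x).1.re.ofReal, (hi c x).2.re.ofReal⟩
    · exact IntervalIntegrable.const_mul ⟨(hi c x).1.im.ofReal, (hi c x).2.im.ofReal⟩ _
  rw [h4]
  refine h3.mono ?_
  rw [Set.uIcc_of_le hpq]
  refine Set.Icc_subset_Icc ?_ ?_
  · exact min_le_right _ _
  · exact le_max_right _ _

theorem integral_eq_sub_of_ae_hasDerivAt {u h : ℝ → ℂ}
    (hu : ∀ a b : ℝ, AbsolutelyContinuousOnInterval u a b) (hh : LocallyIntegrable h)
    (huh : ∀ᵐ t : ℝ, HasDerivAt u (h t) t) (a b : ℝ) : ∫ t in a..b, h t = u b - u a := by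
  have h1 := (hu a b).sub (absolutelyContinuousOnInterval_integral hh a a b)
  obtain ⟨C, hC⟩ := h1.const_of_ae_hasDerivAt_zero (by
    filter_upwards [huh, LocallyIntegrable.ae_hasDerivAt_integral hh] with t h2 h3 _
    simpa using h2.sub (h3 a))
  have ha := hC a Set.left_mem_uIcc
  have hb := hC b Set.right_mem_uIcc
  simp only [Pi.sub_apply, intervalIntegral.integral_same, sub_zero] at ha hb
  rw [ha, ← hb]
  ring

/-- Integrability of `w` gives `v` limits at both infinities, and integrability of `v` forces these
limits to be zero. -/
theorem integral_eq_zero_of_ae_hasDerivAt {v w : ℝ → ℂ}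
    (hv : ∀ a b : ℝ, AbsolutelyContinuousOnInterval v a b) (hvi : Integrable v)
    (hwi : Integrable w) (hvw : ∀ᵐ t : ℝ, HasDerivAt v (w t) t) : ∫ t, w t = 0 := by
  have hint := integral_eq_sub_of_ae_hasDerivAt hv hwi.locallyIntegrable hvw
  have h1 : Tendsto (fun R : ℝ => v R) atTop (𝓝 (v 0 + ∫ t in Set.Ioi 0, w t)) := by
    have := intervalIntegral_tendsto_integral_Ioi 0 hwi.integrableOn tendsto_id
    refine (this.const_add (v 0)).congr fun R => ?_
    rw [hint]; simp
  have h2 : Tendsto (fun R : ℝ => v R) atBot (𝓝 (v 0 - ∫ t in Set.Iic 0, w t)) := by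
    have := intervalIntegral_tendsto_integral_Iic 0 hwi.integrableOn tendsto_id
    refine (this.const_sub (v 0)).congr fun R => ?_
    rw [hint]; simp
  have h3 : v 0 + ∫ t in Set.Ioi 0, w t = 0 :=
    IntegrableAtFilter.eq_zero_of_tendsto (hvi.integrableAtFilter atTop)
      (fun s hs => by
        obtain ⟨a, ha⟩ := mem_atTop_sets.1 hs
        exact measure_mono_top (show Set.Ici a ⊆ s from ha) (by simp)) h1
  have h4 : v 0 - ∫ t in Set.Iic 0, w t = 0 :=
    IntegrableAtFilter.eq_zero_of_tendsto (hvi.integrableAtFilter atBot)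
      (fun s hs => by
        obtain ⟨a, ha⟩ := mem_atBot_sets.1 hs
        exact measure_mono_top (show Set.Iic a ⊆ s from ha) (by simp)) h2
  rw [← intervalIntegral.integral_Iic_add_Ioi hwi.integrableOn hwi.integrableOn (b := 0)]
  linear_combination h3 - h4

open scoped ContDiff in
/-- The lemma of du Bois-Reymond. -/
theorem exists_ae_eq_const_of_integral_deriv_eq_zero {w : ℝ → ℂ} (hw : LocallyIntegrable w)
    (h : ∀ θ : ℝ → ℝ, ContDiff ℝ ∞ θ → HasCompactSupport θ → ∫ t, deriv θ t • w t = 0) :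
    ∃ C : ℂ, w =ᵐ[volume] fun _ => C := by
  let ρ : ContDiffBump (0 : ℝ) := default
  set r : ℝ → ℝ := ρ.normed volume with hr
  have hrs : ContDiff ℝ ∞ r := ρ.contDiff_normed
  have hrc : HasCompactSupport r := ρ.hasCompactSupport_normed
  have hr1 : ∫ t, r t = 1 := ρ.integral_normed
  set C := ∫ t, r t • w t with hC
  refine ⟨C, ?_⟩
  refine ae_eq_of_integral_contDiff_smul_eq hw (locallyIntegrable_const C) fun ψ hψ hψc => ?_
  set M := ∫ t, ψ t with hM
  -- Removing a multiple of the unit-mass bump makes the mean zero, so the primitive of `k` is again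
  -- compactly supported and is an allowed test function.
  set k : ℝ → ℝ := fun t => ψ t - M * r t with hk
  have hks : ContDiff ℝ ∞ k := hψ.sub (contDiff_const.mul hrs)
  have hkc : HasCompactSupport k := hψc.sub hrc.mul_left
  have hψi : Integrable ψ := hψ.continuous.integrable_of_hasCompactSupport hψc
  have hri : Integrable r := hrs.continuous.integrable_of_hasCompactSupport hrc
  have hki : Integrable k := hψi.sub (hri.const_mul M)
  have hk0 : ∫ t, k t = 0 := by
    rw [hk, integral_sub hψi (hri.const_mul M), integral_const_mul, hr1, hM]
    ring
  obtain ⟨R, hR⟩ : ∃ R : ℝ, tsupport k ⊆ Set.Icc (-R) R := by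
    obtain ⟨R, hR⟩ := hkc.isCompact.isBounded.subset_closedBall 0
    exact ⟨R, by simpa [Real.closedBall_eq_Icc] using hR⟩
  have hkout : ∀ t, t ∉ Set.Icc (-R) R → k t = 0 := fun t ht =>
    image_eq_zero_of_notMem_tsupport fun h' => ht (hR h')
  set θ : ℝ → ℝ := fun x => ∫ t in Set.Iic x, k t with hθ
  have hder : ∀ x, HasDerivAt θ (k x) x := by
    intro x
    have h1 : θ = fun y => (∫ t in Set.Iic x, k t) + ∫ t in x..y, k t := by
      ext y
      have := intervalIntegral.integral_Iic_sub_Iic (μ := volume) (f := k) (a := x) (b := y)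
        hki.integrableOn hki.integrableOn
      rw [← this, hθ]
      ring
    rw [h1]
    exact (intervalIntegral.integral_hasDerivAt_right (hki.intervalIntegrable)
      (hks.continuous.stronglyMeasurableAtFilter _ _) hks.continuous.continuousAt).const_add _
  have hderiv : deriv θ = k := funext fun x => (hder x).deriv
  have hθs : ContDiff ℝ ∞ θ := by
    rw [contDiff_infty_iff_deriv]
    exact ⟨fun x => (hder x).differentiableAt, by rw [hderiv]; exact hks⟩
  have hθc : HasCompactSupport θ := by
    refine HasCompactSupport.intro (isCompact_Icc (a := -R) (b := R)) fun x hx => ?_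
    rw [Set.mem_Icc, not_and_or, not_le, not_le] at hx
    rcases hx with hx | hx
    · rw [hθ]
      refine setIntegral_eq_zero_of_forall_eq_zero fun t ht => hkout t fun h' => ?_
      rw [Set.mem_Iic] at ht
      linarith [h'.1]
    · rw [hθ, ← hk0]
      refine setIntegral_eq_integral_of_forall_compl_eq_zero fun t ht => hkout t fun h' => ?_
      rw [Set.mem_Iic, not_le] at ht
      linarith [h'.2]
  have h1 := h θ hθs hθc
  rw [hderiv] at h1
  have hψw : Integrable (fun t => ψ t • w t) :=
    hw.integrable_smul_left_of_hasCompactSupport hψ.continuous hψc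
  have hrw : Integrable (fun t => r t • w t) :=
    hw.integrable_smul_left_of_hasCompactSupport hrs.continuous hrc
  have h2 : ∫ t, k t • w t = (∫ t, ψ t • w t) - M • C := by
    rw [hC, ← integral_smul, ← integral_sub hψw (g := fun t => M • r t • w t) (hrw.smul M)]
    refine integral_congr_ae (ae_of_all _ fun t => ?_)
    simp [hk, sub_smul, mul_smul]
  rw [integral_smul_const, ← hM, ← sub_eq_zero, ← h2, h1]

end AbsolutelyContinuousFunctions

/-! ### Weak derivatives in `L²` and the Fourier transform -/

section WeakDerivative

open scoped SchwartzMap FourierTransform ContDiff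

/-- `g ∈ L²` has a locally absolutely continuous representative with derivative `h ∈ L²`. -/
def HasACDeriv (g h : Lp ℂ 2 (volume : Measure ℝ)) : Prop :=
  ∃ u : ℝ → ℂ, (∀ a b : ℝ, AbsolutelyContinuousOnInterval u a b) ∧
    (g : ℝ → ℂ) =ᵐ[volume] u ∧ ∀ᵐ t : ℝ, HasDerivAt u (h t) t

theorem locallyIntegrable_of_Lp_two (g : Lp ℂ 2 (volume : Measure ℝ)) :
    LocallyIntegrable (g : ℝ → ℂ) :=
  (Lp.memLp g).locallyIntegrable (by norm_num)

theorem integrable_schwartz_mul (θ : 𝓢(ℝ, ℂ)) (g : Lp ℂ 2 (volume : Measure ℝ)) :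
    Integrable (fun t => θ t * g t) :=
  (θ.memLp 2).integrable_mul (Lp.memLp g)

/-- Integration by parts without boundary terms: `θu` and its derivative are integrable, being built
from products of `L²` functions. -/
theorem HasACDeriv.integral_deriv_mul {g h : Lp ℂ 2 (volume : Measure ℝ)} (hgh : HasACDeriv g h)
    (θ : 𝓢(ℝ, ℂ)) :
    ∫ t, SchwartzMap.derivCLM ℂ ℂ θ t * g t = - ∫ t, θ t * h t := by
  obtain ⟨u, hu, hgu, huh⟩ := hgh
  have h1 : Integrable (fun t => θ t * u t) :=
    (integrable_schwartz_mul θ g).congr (by filter_upwards [hgu] with t ht; rw [ht])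
  have h2 : Integrable (fun t => SchwartzMap.derivCLM ℂ ℂ θ t * g t + θ t * h t) :=
    (integrable_schwartz_mul _ g).add (integrable_schwartz_mul θ h)
  have hac : ∀ a b : ℝ, AbsolutelyContinuousOnInterval (fun t => θ t * u t) a b := fun a b =>
    ((θ.smooth 1).contDiffOn.absolutelyContinuousOnInterval).smul (hu a b)
  have h3 := integral_eq_zero_of_ae_hasDerivAt hac h1 h2 (by
    filter_upwards [hgu, huh] with t h4 h5
    rw [h4]
    exact (θ.differentiableAt (x := t)).hasDerivAt.mul h5)
  rw [integral_add (integrable_schwartz_mul _ g) (integrable_schwartz_mul θ h)] at h3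
  exact eq_neg_of_add_eq_zero_left h3

/-- A weak derivative is a classical one: `g` minus a primitive of `h` has zero weak derivative,
hence is a.e. constant by du Bois-Reymond. -/
theorem hasACDeriv_of_integral_deriv_mul {g h : Lp ℂ 2 (volume : Measure ℝ)}
    (H : ∀ θ : 𝓢(ℝ, ℂ), ∫ t, SchwartzMap.derivCLM ℂ ℂ θ t * g t = - ∫ t, θ t * h t) :
    HasACDeriv g h := by
  have hg := locallyIntegrable_of_Lp_two g
  have hh := locallyIntegrable_of_Lp_two h
  set u : ℝ → ℂ := fun x => ∫ t in (0 : ℝ)..x, h t with hu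
  have hac : ∀ a b : ℝ, AbsolutelyContinuousOnInterval u a b :=
    absolutelyContinuousOnInterval_integral hh 0
  have hud : ∀ᵐ t : ℝ, HasDerivAt u (h t) t := by
    filter_upwards [LocallyIntegrable.ae_hasDerivAt_integral hh] with t ht using ht 0
  have hcont : Continuous u := by
    rw [continuous_iff_continuousAt]
    intro t
    refine (hac (t - 1) (t + 1)).continuousOn.continuousAt ?_
    rw [Set.uIcc_of_le (by linarith)]
    exact Icc_mem_nhds (by linarith) (by linarith)
  have hul : LocallyIntegrable u := hcont.locallyIntegrable
  obtain ⟨C, hC⟩ := exists_ae_eq_const_of_integral_deriv_eq_zero (hg.sub hul) (by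
    intro θ hθ hθc
    have hθ1 : HasCompactSupport (Complex.ofRealCLM ∘ θ) := hθc.comp_left rfl
    have hθ2 : ContDiff ℝ ∞ (Complex.ofRealCLM ∘ θ) := by fun_prop
    have hd : Continuous (deriv θ) := hθ.continuous_deriv (by simp)
    have hdt : ∀ t, HasDerivAt θ (deriv θ t) t := fun t =>
      (hθ.differentiable (by simp) t).hasDerivAt
    have hdg : Integrable (fun t => deriv θ t • (g : ℝ → ℂ) t) :=
      hg.integrable_smul_left_of_hasCompactSupport hd hθc.deriv
    have hdu : Integrable (fun t => deriv θ t • u t) :=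
      hul.integrable_smul_left_of_hasCompactSupport hd hθc.deriv
    have hth : Integrable (fun t => θ t • (h : ℝ → ℂ) t) :=
      hh.integrable_smul_left_of_hasCompactSupport hθ.continuous hθc
    have hθu : Integrable (fun t => θ t • u t) :=
      hul.integrable_smul_left_of_hasCompactSupport hθ.continuous hθc
    have h1 : ∫ t, deriv θ t • (g : ℝ → ℂ) t = - ∫ t, θ t • (h : ℝ → ℂ) t := by
      have h2 := H (hθ1.toSchwartzMap hθ2)
      have h3 : ∀ t, SchwartzMap.derivCLM ℂ ℂ (hθ1.toSchwartzMap hθ2) t = ((deriv θ t : ℝ) : ℂ) :=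
        fun t => (hdt t).ofReal_comp.deriv
      simp only [h3] at h2
      simpa using h2
    have h2 : ∫ t, (deriv θ t • u t + θ t • (h : ℝ → ℂ) t) = 0 := by
      refine integral_eq_zero_of_ae_hasDerivAt (v := fun t => θ t • u t) (fun a b => ?_) hθu
        (hdu.add hth) ?_
      · exact ((hθ.of_le (by simp)).contDiffOn.absolutelyContinuousOnInterval).smul (hac a b)
      · filter_upwards [hud] with t ht
        have := (hdt t).smul ht
        rwa [add_comm] at this
    rw [integral_add hdu hth] at h2
    simp only [Pi.sub_apply, smul_sub]
    rw [integral_sub hdg hdu, h1]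
    linear_combination -h2)
  refine ⟨fun t => u t + C, fun a b => ?_, ?_, ?_⟩
  · exact (hac a b).add
      (contDiff_const (c := C) (n := 1)).contDiffOn.absolutelyContinuousOnInterval
  · filter_upwards [hC] with t ht
    simp only [Pi.sub_apply] at ht
    rw [← ht]
    ring
  · filter_upwards [hud] with t ht
    exact ht.add_const C

theorem fourier_integral_mul (g : Lp ℂ 2 (volume : Measure ℝ)) (η : 𝓢(ℝ, ℂ)) :
    ∫ t, 𝓕 η t * g t = ∫ t, η t * (𝓕 g : Lp ℂ 2 (volume : Measure ℝ)) t := by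
  have h := congrArg (fun T : 𝓢'(ℝ, ℂ) => T η) (Lp.fourier_toTemperedDistribution_eq g)
  simpa using h

theorem derivCLM_fourier (η : 𝓢(ℝ, ℂ)) :
    SchwartzMap.derivCLM ℂ ℂ (𝓕 η) =
      𝓕 (-(2 * Real.pi * Complex.I) • SchwartzMap.smulLeftCLM ℂ (fun x : ℝ => (x : ℂ)) η) := by
  have h := SchwartzMap.lineDerivOp_fourier_eq η (1 : ℝ)
  have h1 : (fun x : ℝ => inner ℝ x (1 : ℝ)).HasTemperateGrowth := by fun_prop
  rw [← SchwartzMap.smulLeftCLM_ofReal ℂ h1] at h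
  have h2 : LineDeriv.lineDerivOp (1 : ℝ) (𝓕 η) = SchwartzMap.derivCLM ℂ ℂ (𝓕 η) := by
    ext t
    rw [SchwartzMap.lineDerivOp_apply_eq_fderiv, SchwartzMap.derivCLM_apply,
      fderiv_apply_one_eq_deriv]
  rw [← h2, h]
  simp

/-- In `L²`, differentiation corresponds to multiplication by `2πiξ` on the Fourier side. -/
theorem hasACDeriv_iff_fourier (g h : Lp ℂ 2 (volume : Measure ℝ)) :
    HasACDeriv g h ↔ ∀ᵐ ξ : ℝ, (𝓕 h : Lp ℂ 2 (volume : Measure ℝ)) ξ =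
      2 * Real.pi * Complex.I * ξ * (𝓕 g : Lp ℂ 2 (volume : Measure ℝ)) ξ := by
  have htg : (fun x : ℝ => (x : ℂ)).HasTemperateGrowth := by fun_prop
  -- Every Schwartz function is some `𝓕 η`, so testing against these loses nothing and moves the
  -- derivative to the frequency side.
  have key : ∀ η : 𝓢(ℝ, ℂ), ∫ t, SchwartzMap.derivCLM ℂ ℂ (𝓕 η) t * g t =
      - ∫ ξ : ℝ, η ξ * (2 * Real.pi * Complex.I * ξ * (𝓕 g : Lp ℂ 2 (volume : Measure ℝ)) ξ) := by
    intro η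
    rw [derivCLM_fourier, fourier_integral_mul, ← integral_neg]
    refine integral_congr_ae (ae_of_all _ fun ξ => ?_)
    simp [SchwartzMap.smulLeftCLM_apply_apply htg]
    ring
  have hloc : LocallyIntegrable fun ξ : ℝ =>
      2 * Real.pi * Complex.I * ξ * (𝓕 g : Lp ℂ 2 (volume : Measure ℝ)) ξ := by
    have hc : Continuous fun ξ : ℝ => (2 * Real.pi * Complex.I * ξ : ℂ) := by fun_prop
    exact (locallyIntegrable_of_Lp_two (𝓕 g)).continuous_mul hc
  constructor
  · intro H
    refine ae_eq_of_integral_contDiff_smul_eq (locallyIntegrable_of_Lp_two _) hloc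
      fun θ hθ hθc => ?_
    have hθ1 : HasCompactSupport (Complex.ofRealCLM ∘ θ) := hθc.comp_left rfl
    have hθ2 : ContDiff ℝ ∞ (Complex.ofRealCLM ∘ θ) := by fun_prop
    have h1 := key (hθ1.toSchwartzMap hθ2)
    rw [H.integral_deriv_mul, neg_inj, fourier_integral_mul] at h1
    simpa using h1
  · intro H
    refine hasACDeriv_of_integral_deriv_mul fun θ => ?_
    have h1 := key (𝓕⁻ θ)
    have h2 := fourier_integral_mul h (𝓕⁻ θ)
    rw [FourierTransform.fourier_fourierInv_eq] at h1 h2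
    rw [h1, h2, neg_inj]
    refine integral_congr_ae ?_
    filter_upwards [H] with ξ hξ
    rw [hξ]

end WeakDerivative

/-! ### Projection-valued measures: elementary properties -/

section ProjectionValuedMeasures

variable {H : Type*} [NormedAddCommGroup H] [InnerProductSpace ℂ H] [CompleteSpace H]

namespace ProjectionValuedMeasure

variable (E : ProjectionValuedMeasure H)

theorem measure_apply (x : H) {s : Set ℝ} (hs : MeasurableSet s) :
    E.measure x s = ENNReal.ofReal (‖E.proj s x‖ ^ 2) := by
  rw [measure, Measure.ofMeasurable_apply s hs]

theorem measure_univ (x : H) : E.measure x Set.univ = ENNReal.ofReal (‖x‖ ^ 2) := by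
  rw [E.measure_apply x MeasurableSet.univ, E.proj_univ]
  rfl

instance isFiniteMeasure_measure (x : H) : IsFiniteMeasure (E.measure x) :=
  ⟨by rw [E.measure_univ x]; exact ENNReal.ofReal_lt_top⟩

theorem proj_proj {s t : Set ℝ} (hs : MeasurableSet s) (ht : MeasurableSet t) (x : H) :
    E.proj s (E.proj t x) = E.proj (s ∩ t) x := by
  rw [E.proj_inter s t hs ht]
  rfl

theorem inner_proj {s : Set ℝ} (hs : MeasurableSet s) (x y : H) :
    inner ℂ (E.proj s x) y = inner ℂ x (E.proj s y) := by
  have h := ContinuousLinearMap.adjoint_inner_left (E.proj s) y x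
  have h4 : ContinuousLinearMap.adjoint (E.proj s) = E.proj s :=
    (E.isStarProjection s hs).isSelfAdjoint
  rwa [h4] at h

theorem measure_eq_zero_iff (x : H) {s : Set ℝ} (hs : MeasurableSet s) :
    E.measure x s = 0 ↔ E.proj s x = 0 := by
  rw [E.measure_apply x hs, ENNReal.ofReal_eq_zero]
  constructor
  · intro h
    have : ‖E.proj s x‖ ^ 2 = 0 := le_antisymm h (by positivity)
    simpa using this
  · intro h
    simp [h]

/-- Both projections annihilate the defect `d`, so its scalar measure vanishes on `s` and on `sᶜ`;
its total mass is `‖d‖²`. -/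
theorem proj_compl_add {s : Set ℝ} (hs : MeasurableSet s) (x : H) :
    E.proj s x + E.proj sᶜ x = x := by
  set d := x - (E.proj s x + E.proj sᶜ x) with hd
  have h1 : E.proj s d = 0 := by
    rw [hd, map_sub, map_add, E.proj_proj hs hs, E.proj_proj hs hs.compl, Set.inter_self,
      Set.inter_compl_self, E.proj_empty]
    simp
  have h2 : E.proj sᶜ d = 0 := by
    rw [hd, map_sub, map_add, E.proj_proj hs.compl hs, E.proj_proj hs.compl hs.compl,
      Set.inter_self, Set.compl_inter_self, E.proj_empty]
    simp
  have h3 : E.measure d Set.univ = 0 := by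
    rw [← Set.union_compl_self s]
    exact measure_union_null ((E.measure_eq_zero_iff d hs).2 h1)
      ((E.measure_eq_zero_iff d hs.compl).2 h2)
  rw [E.measure_eq_zero_iff d MeasurableSet.univ, E.proj_univ] at h3
  exact (sub_eq_zero.1 h3).symm

theorem measure_proj (x : H) {s : Set ℝ} (hs : MeasurableSet s) :
    E.measure (E.proj s x) = (E.measure x).restrict s := by
  ext t ht
  rw [Measure.restrict_apply ht, E.measure_apply _ ht, E.measure_apply _ (ht.inter hs),
    E.proj_proj ht hs]

/-- Pythagoras: `E(t)x` and `E(t)y` are orthogonal for every Borel set `t`. -/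
theorem measure_add_of_proj {s : Set ℝ} (hs : MeasurableSet s) {x y : H} (hx : E.proj s x = x)
    (hy : E.proj sᶜ y = y) : E.measure (y + x) = E.measure y + E.measure x := by
  ext t ht
  rw [Measure.add_apply, E.measure_apply _ ht, E.measure_apply _ ht, E.measure_apply _ ht,
    ← ENNReal.ofReal_add (by positivity) (by positivity), map_add]
  have h0 : inner ℂ (E.proj t y) (E.proj t x) = 0 := by
    rw [← hx, ← hy, E.inner_proj ht, E.inner_proj hs.compl, E.proj_proj ht ht, E.proj_proj
      (ht.inter ht) hs, E.proj_proj hs.compl ((ht.inter ht).inter hs)]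
    have : sᶜ ∩ (t ∩ t ∩ s) = ∅ := by
      ext z
      simp only [Set.mem_inter_iff, Set.mem_compl_iff, Set.mem_empty_iff_false, iff_false]
      tauto
    rw [this, E.proj_empty]
    simp
  have h1 := norm_add_sq (𝕜 := ℂ) (E.proj t y) (E.proj t x)
  rw [h0] at h1
  rw [h1]
  simp

end ProjectionValuedMeasure

end ProjectionValuedMeasures

/-! ### Operators that are unitarily equivalent to multiplication operators -/

section Model

variable {X : Type*} [MeasurableSpace X] {ν : Measure X}
variable {H : Type*} [NormedAddCommGroup H] [InnerProductSpace ℂ H]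

/-- `U` is a unitary that transforms `V` into multiplication by the real function `m`, with maximal
domain. -/
def IsMulModel (V : H →ₗ.[ℂ] H) (U : H ≃ₗᵢ[ℂ] Lp ℂ 2 ν) (m : X → ℝ) : Prop :=
  ∀ x y : H, (x, y) ∈ V.graph ↔ ∀ᵐ ξ ∂ν, U y ξ = m ξ * U x ξ

theorem mem_domain_iff_exists_graph (V : H →ₗ.[ℂ] H) (x : H) :
    x ∈ V.domain ↔ ∃ y, (x, y) ∈ V.graph := by
  constructor
  · intro hx
    exact ⟨V ⟨x, hx⟩, V.mem_graph ⟨x, hx⟩⟩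
  · rintro ⟨y, hy⟩
    exact LinearPMap.mem_domain_of_mem_graph hy

variable {V : H →ₗ.[ℂ] H} {U : H ≃ₗᵢ[ℂ] Lp ℂ 2 ν} {m : X → ℝ}

theorem IsMulModel.inner_symm (hV : IsMulModel V U m) {x y x' y' : H} (h : (x, y) ∈ V.graph)
    (h' : (x', y') ∈ V.graph) : inner ℂ y x' = inner ℂ x y' := by
  rw [← U.inner_map_map, ← U.inner_map_map x, L2.inner_def, L2.inner_def]
  refine integral_congr_ae ?_
  filter_upwards [(hV x y).1 h, (hV x' y').1 h'] with ξ h1 h2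
  rw [h1, h2]
  simp only [RCLike.inner_apply, map_mul, Complex.conj_ofReal]
  ring

theorem IsMulModel.mem_domain_iff (hV : IsMulModel V U m) (hm : Measurable m) (x : H) :
    x ∈ V.domain ↔ Integrable (fun t : ℝ => t ^ 2) ((sqDensity (U x)).map m) := by
  have hUx : AEStronglyMeasurable (fun ξ => (m ξ : ℂ) * U x ξ) ν :=
    (Complex.measurable_ofReal.comp hm).aestronglyMeasurable.mul (Lp.aestronglyMeasurable _)
  have h1 : Integrable (fun t : ℝ => t ^ 2) ((sqDensity (U x)).map m) ↔
      MemLp (fun ξ => (m ξ : ℂ) * U x ξ) 2 ν := by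
    rw [integrable_map_measure (by fun_prop) hm.aemeasurable, integrable_sqDensity_iff,
      memLp_two_iff_integrable_sq_norm hUx]
    refine integrable_congr (ae_of_all _ fun ξ => ?_)
    simp only [Function.comp, smul_eq_mul, norm_mul, Complex.norm_real, Real.norm_eq_abs, mul_pow,
      sq_abs]
    ring
  rw [h1, mem_domain_iff_exists_graph]
  constructor
  · rintro ⟨y, hy⟩
    rw [hV x y] at hy
    exact (Lp.memLp (U y)).ae_eq hy
  · intro h
    refine ⟨U.symm (h.toLp _), (hV _ _).2 ?_⟩
    rw [LinearIsometryEquiv.apply_symm_apply]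
    exact h.coeFn_toLp

variable [CompleteSpace H]

theorem IsMulModel.resolves_mulPVM (hV : IsMulModel V U m) (hm : Measurable m) :
    (mulPVM U m hm).Resolves V := by
  constructor
  · intro x
    rw [mulPVM_measure, hV.mem_domain_iff hm]
  · intro x
    have h := (hV x (V x)).1 (V.mem_graph x)
    rw [mulPVM_measure, integral_map hm.aemeasurable (by fun_prop), integral_sqDensity,
      ← U.inner_map_map, L2.inner_def]
    refine integral_congr_ae ?_
    filter_upwards [h] with ξ hξ
    rw [hξ]
    simp only [RCLike.inner_apply]
    ring

variable {E : ProjectionValuedMeasure H}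

theorem ProjectionValuedMeasure.Resolves.inner_eq (hE : E.Resolves V) {x y : H}
    (h : (x, y) ∈ V.graph) :
    Integrable (fun t : ℝ => t ^ 2) (E.measure x) ∧
      inner ℂ x y = ∫ t : ℝ, (t : ℂ) ∂(E.measure x) := by
  obtain ⟨z, hz1, hz2⟩ := (LinearPMap.mem_graph_iff V).1 h
  simp only at hz1 hz2
  subst hz1 hz2
  exact ⟨(hE.1 z).1 z.2, hE.2 z⟩

theorem integrable_ofReal_of_integrable_sq {μ : Measure ℝ} [IsFiniteMeasure μ]
    (h : Integrable (fun t : ℝ => t ^ 2) μ) : Integrable (fun t : ℝ => (t : ℂ)) μ := by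
  have : MemLp (fun t : ℝ => t) 2 μ := (memLp_two_iff_integrable_sq (by fun_prop)).2 h
  exact (this.integrable (by norm_num)).ofReal

/-- If `x` and `y` lie in complementary spectral subspaces, then `V x` is orthogonal to `y`. -/
theorem ProjectionValuedMeasure.Resolves.inner_eq_zero (hE : E.Resolves V) {s : Set ℝ}
    (hs : MeasurableSet s) {x y x' y' : H} (h : (x, x') ∈ V.graph) (h' : (y, y') ∈ V.graph)
    (hx : E.proj s x = x) (hy : E.proj sᶜ y = y) : inner ℂ y x' = 0 := by
  -- `Resolves` controls only the quadratic form. Additivity of the measures kills its cross terms,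
  -- and the scalars `1` and `I` then separate the two inner products.
  have hadd : ∀ c : ℂ, inner ℂ y (c • x') + inner ℂ (c • x) y' = 0 := by
    intro c
    have hc : (c • x, c • x') ∈ V.graph := V.graph.smul_mem c h
    have hxc : E.proj s (c • x) = c • x := by rw [map_smul, hx]
    have h1 := hE.inner_eq (V.graph.add_mem h' hc)
    have h2 := hE.inner_eq h'
    have h3 := hE.inner_eq hc
    simp only at h1
    rw [E.measure_add_of_proj hs hxc hy] at h1
    have h4 := h1.2
    rw [integral_add_measure (integrable_ofReal_of_integrable_sq h2.1)
      (integrable_ofReal_of_integrable_sq h3.1), ← h2.2, ← h3.2] at h4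
    simp only [inner_add_left, inner_add_right] at h4 ⊢
    linear_combination h4
  have h1 := hadd 1
  have h2 := hadd Complex.I
  simp only [one_smul, inner_smul_left, inner_smul_right, Complex.conj_I] at h1 h2
  have h3 : Complex.I * (2 * inner ℂ y x') = 0 := by linear_combination h2 + Complex.I * h1
  simpa using h3

theorem ProjectionValuedMeasure.Resolves.mem_domain_of_proj (hE : E.Resolves V) {a b : ℝ}
    {s : Set ℝ} (hs : MeasurableSet s) (hsab : s ⊆ Set.Icc a b) {x : H} (hx : E.proj s x = x) :
    ∃ y, (x, y) ∈ V.graph := by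
  rw [← mem_domain_iff_exists_graph, hE.1, ← hx, E.measure_proj x hs]
  have : IntegrableOn (fun t : ℝ => t ^ 2) (Set.Icc a b) (E.measure x) :=
    (continuous_pow 2).continuousOn.integrableOn_compact isCompact_Icc
  exact this.mono_set hsab

/-- Spectral subspaces are invariant under `V`. -/
theorem ProjectionValuedMeasure.Resolves.proj_eq_of_graph (hE : E.Resolves V) {s : Set ℝ}
    (hs : MeasurableSet s) {x y : H} (h : (x, y) ∈ V.graph) (hx : E.proj s x = x) :
    E.proj s y = y := by
  -- Cutting down to a bounded set puts the component `w` of `y` into the domain of `V`. Then `y =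
  -- Vx` is orthogonal to `w`, while `⟪w, y⟫ = ‖w‖²`.
  have h0 : ∀ n : ℕ, E.measure y (sᶜ ∩ Set.Icc (-n : ℝ) n) = 0 := by
    intro n
    have hsn : MeasurableSet (sᶜ ∩ Set.Icc (-n : ℝ) n) := hs.compl.inter measurableSet_Icc
    set w := E.proj (sᶜ ∩ Set.Icc (-n : ℝ) n) y with hw
    have hw1 : E.proj (sᶜ ∩ Set.Icc (-n : ℝ) n) w = w := by
      rw [hw, E.proj_proj hsn hsn, Set.inter_self]
    have hw2 : E.proj sᶜ w = w := by
      rw [hw, E.proj_proj hs.compl hsn, ← Set.inter_assoc, Set.inter_self]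
    obtain ⟨w', hw'⟩ := hE.mem_domain_of_proj hsn Set.inter_subset_right hw1
    have h1 := hE.inner_eq_zero hs h hw' hx hw2
    rw [← hw1, E.inner_proj hsn, ← hw, inner_self_eq_zero] at h1
    exact (E.measure_eq_zero_iff y hsn).2 h1
  have h1 : E.measure y sᶜ = 0 := by
    have : sᶜ = ⋃ n : ℕ, sᶜ ∩ Set.Icc (-n : ℝ) n := by
      rw [← Set.inter_iUnion, Set.left_eq_inter]
      intro t _
      obtain ⟨n, hn⟩ := exists_nat_ge |t|
      exact Set.mem_iUnion.2 ⟨n, abs_le.1 hn⟩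
    rw [this]
    exact measure_iUnion_null h0
  rw [E.measure_eq_zero_iff y hs.compl] at h1
  have h2 := E.proj_compl_add hs y
  rwa [h1, add_zero] at h2

theorem ProjectionValuedMeasure.Resolves.abs_re_inner_le (hE : E.Resolves V) {c r : ℝ} {x y : H}
    (h : (x, y) ∈ V.graph) (hx : E.proj (Set.Icc (c - r) (c + r)) x = x) :
    |(inner ℂ x (y - (c : ℂ) • x)).re| ≤ r * ‖x‖ ^ 2 := by
  obtain ⟨h1, h2⟩ := hE.inner_eq h
  have hi := integrable_ofReal_of_integrable_sq h1
  have hr : (E.measure x).real Set.univ = ‖x‖ ^ 2 := by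
    rw [Measure.real, E.measure_univ, ENNReal.toReal_ofReal (by positivity)]
  have h3 : inner ℂ x (y - (c : ℂ) • x) = ∫ t : ℝ, ((t : ℂ) - c) ∂(E.measure x) := by
    rw [integral_sub hi (integrable_const _), integral_const, hr, inner_sub_right, h2,
      inner_smul_right, inner_self_eq_norm_sq_to_K]
    simp [mul_comm]
  rw [h3, ← hr]
  refine (Complex.abs_re_le_norm _).trans (norm_integral_le_of_norm_le_const ?_)
  rw [← hx, E.measure_proj x measurableSet_Icc]
  refine (ae_restrict_iff' measurableSet_Icc).2 (ae_of_all _ fun t ht => ?_)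
  rw [← Complex.ofReal_sub, Complex.norm_real, Real.norm_eq_abs, abs_le]
  constructor <;> linarith [ht.1, ht.2]

/-- For a symmetric operator, a bound on the quadratic form is a bound on the norm. The proof
evaluates the form of `V - c` at real combinations of `x` and `z = (V - c)x`; by symmetry the cross
term is `2αβ‖z‖²`. -/
theorem IsMulModel.norm_sub_smul_le (hV : IsMulModel V U m) (hE : E.Resolves V) {c r : ℝ}
    {x y : H} (h : (x, y) ∈ V.graph) (hx : E.proj (Set.Icc (c - r) (c + r)) x = x) :
    ‖y - (c : ℂ) • x‖ ≤ r * ‖x‖ := by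
  set P := E.proj (Set.Icc (c - r) (c + r)) with hP
  set z := y - (c : ℂ) • x with hz
  have hy : P y = y := hE.proj_eq_of_graph measurableSet_Icc h hx
  have hPz : P z = z := by rw [hz, map_sub, map_smul, hx, hy]
  obtain ⟨w, hw⟩ := hE.mem_domain_of_proj measurableSet_Icc subset_rfl hPz
  set z' := w - (c : ℂ) • z with hz'
  have hsymm : inner ℂ x z' = ((‖z‖ ^ 2 : ℝ) : ℂ) := by
    have h1 := hV.inner_symm h hw
    have h2 : inner ℂ z z = ((‖z‖ ^ 2 : ℝ) : ℂ) := by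
      rw [inner_self_eq_norm_sq_to_K]; simp
    rw [← h2]
    nth_rw 2 [hz]
    rw [hz', inner_sub_right, inner_sub_left, inner_smul_right, inner_smul_left, h1,
      Complex.conj_ofReal]
  have hform : ∀ α β : ℝ, α ^ 2 * (inner ℂ x z).re + 2 * α * β * ‖z‖ ^ 2 +
      β ^ 2 * (inner ℂ z z').re ≤ r * ‖(α : ℂ) • x + (β : ℂ) • z‖ ^ 2 ∧
      -(α ^ 2 * (inner ℂ x z).re + 2 * α * β * ‖z‖ ^ 2 +
      β ^ 2 * (inner ℂ z z').re) ≤ r * ‖(α : ℂ) • x + (β : ℂ) • z‖ ^ 2 := by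
    intro α β
    have hg := V.graph.add_mem (V.graph.smul_mem (α : ℂ) h) (V.graph.smul_mem (β : ℂ) hw)
    simp only [Prod.smul_mk, Prod.mk_add_mk] at hg
    have hPg : P ((α : ℂ) • x + (β : ℂ) • z) = (α : ℂ) • x + (β : ℂ) • z := by
      rw [map_add, map_smul, map_smul, hx, hPz]
    have h1 := hE.abs_re_inner_le hg hPg
    have h2 : (α : ℂ) • y + (β : ℂ) • w - (c : ℂ) • ((α : ℂ) • x + (β : ℂ) • z) =
        (α : ℂ) • z + (β : ℂ) • z' := by
      rw [hz', hz]
      module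
    have h3 : (inner ℂ ((α : ℂ) • x + (β : ℂ) • z) ((α : ℂ) • z + (β : ℂ) • z')).re =
        α ^ 2 * (inner ℂ x z).re + 2 * α * β * ‖z‖ ^ 2 + β ^ 2 * (inner ℂ z z').re := by
      have h4 : inner ℂ z z = ((‖z‖ ^ 2 : ℝ) : ℂ) := by
        rw [inner_self_eq_norm_sq_to_K]; simp
      simp only [inner_add_left, inner_add_right, inner_smul_left, inner_smul_right, hsymm, h4,
        Complex.conj_ofReal, Complex.add_re, Complex.re_ofReal_mul, Complex.ofReal_re]
      ring
    rw [h2, h3] at h1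
    exact ⟨(abs_le.1 h1).2, by linarith [(abs_le.1 h1).1]⟩
  have hpar := parallelogram_law_with_norm ℂ (((‖z‖ : ℝ) : ℂ) • x) (((‖x‖ : ℝ) : ℂ) • z)
  -- These weights give both summands the norm `‖x‖ * ‖z‖`. Subtracting the two values of the form
  -- leaves the cross term, and the parallelogram law evaluates the right-hand sides.
  have h1 := (hform ‖z‖ ‖x‖).1
  have h2 := (hform ‖z‖ (-‖x‖)).2
  have h3 : ((‖z‖ : ℝ) : ℂ) • x + ((-‖x‖ : ℝ) : ℂ) • z =
      ((‖z‖ : ℝ) : ℂ) • x - ((‖x‖ : ℝ) : ℂ) • z := by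
    push_cast
    module
  rw [h3] at h2
  have h4 : ‖((‖z‖ : ℝ) : ℂ) • x‖ = ‖z‖ * ‖x‖ := by
    rw [norm_smul, Complex.norm_real, norm_norm]
  have h5 : ‖((‖x‖ : ℝ) : ℂ) • z‖ = ‖x‖ * ‖z‖ := by
    rw [norm_smul, Complex.norm_real, norm_norm]
  rw [h4, h5] at hpar
  have h6 : 4 * ‖z‖ * ‖x‖ * ‖z‖ ^ 2 ≤ r * (4 * (‖z‖ * ‖x‖) ^ 2) := by
    have h7 := congrArg (r * ·) hpar
    simp only [mul_add] at h7
    linarith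
  by_cases hx0 : ‖x‖ = 0
  · have hx0' : x = 0 := norm_eq_zero.1 hx0
    have : y = 0 := by
      have := V.graph_fst_eq_zero_snd (x := x) (x' := y) h hx0'
      exact this
    rw [hz, this, hx0']
    simp
  -- Here `0 ≤ r` is still needed; it follows from the form bound, as `x ≠ 0`.
  by_cases hz0 : ‖z‖ = 0
  · have h7 := hE.abs_re_inner_le h hx
    have hr : 0 ≤ r * ‖x‖ ^ 2 := (abs_nonneg _).trans h7
    have hxp : 0 < ‖x‖ := lt_of_le_of_ne (norm_nonneg _) (Ne.symm hx0)
    have hr' : 0 ≤ r := nonneg_of_mul_nonneg_left hr (by positivity)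
    rw [hz0]
    positivity
  have hxp : 0 < ‖x‖ := lt_of_le_of_ne (norm_nonneg _) (Ne.symm hx0)
  have hzp : 0 < ‖z‖ := lt_of_le_of_ne (norm_nonneg _) (Ne.symm hz0)
  have h8 : (4 * ‖x‖ * ‖z‖ ^ 2) * ‖z‖ ≤ (4 * ‖x‖ * ‖z‖ ^ 2) * (r * ‖x‖) := by
    nlinarith
  exact le_of_mul_le_mul_left h8 (by positivity)

end Model

/-! ### Uniqueness of the spectral measure -/

section Uniqueness

variable {X : Type*} [MeasurableSpace X] {ν : Measure X}
variable {H : Type*} [NormedAddCommGroup H] [InnerProductSpace ℂ H] [CompleteSpace H]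
variable {V : H →ₗ.[ℂ] H} {U : H ≃ₗᵢ[ℂ] Lp ℂ 2 ν} {m : X → ℝ}
variable {E : ProjectionValuedMeasure H}

/-- The vector `y` is `(V - c)^k x`. Invariance of the spectral subspace keeps every iterate in the
domain and under the same norm bound. -/
theorem IsMulModel.exists_iterate (hV : IsMulModel V U m) (hE : E.Resolves V) {c r : ℝ}
    (hr : 0 ≤ r) {x : H} (hx : E.proj (Set.Icc (c - r) (c + r)) x = x) (k : ℕ) :
    ∃ y, E.proj (Set.Icc (c - r) (c + r)) y = y ∧
      (∀ᵐ ξ ∂ν, U y ξ = ((m ξ - c : ℝ) : ℂ) ^ k * U x ξ) ∧ ‖y‖ ≤ r ^ k * ‖x‖ := by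
  induction k with
  | zero => exact ⟨x, hx, by simp, by simp⟩
  | succ k ih =>
    obtain ⟨y, hy1, hy2, hy3⟩ := ih
    obtain ⟨z, hz⟩ := hE.mem_domain_of_proj measurableSet_Icc subset_rfl hy1
    refine ⟨z - (c : ℂ) • y, ?_, ?_, ?_⟩
    · rw [map_sub, map_smul, hy1, hE.proj_eq_of_graph measurableSet_Icc hz hy1]
    · rw [map_sub, map_smul]
      filter_upwards [(hV y z).1 hz, hy2, Lp.coeFn_sub (U z) ((c : ℂ) • U y),
        Lp.coeFn_smul (c : ℂ) (U y)] with ξ h1 h2 h3 h4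
      rw [h3, Pi.sub_apply, h4, Pi.smul_apply, h1, h2]
      push_cast
      simp only [smul_eq_mul]
      ring
    · calc ‖z - (c : ℂ) • y‖ ≤ r * ‖y‖ := hV.norm_sub_smul_le hE hz hy1
        _ ≤ r * (r ^ k * ‖x‖) := by gcongr
        _ = r ^ (k + 1) * ‖x‖ := by ring

/-- Where `|m - c| ≥ r + δ`, the `k`-th iterate is at least `(r + δ)^k` times `|Ux|`, yet its norm
is at most `r^k ‖x‖`. Letting `k → ∞` leaves no mass there. -/
theorem IsMulModel.mulOp_indicator_eq_zero (hV : IsMulModel V U m) (hE : E.Resolves V)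
    (hm : Measurable m) {c r : ℝ} (hr : 0 ≤ r) {x : H}
    (hx : E.proj (Set.Icc (c - r) (c + r)) x = x) {δ : ℝ} (hδ : 0 < δ) :
    mulOp ν ({ξ | r + δ ≤ |m ξ - c|}.indicator fun _ => (1 : ℂ)) (U x) = 0 := by
  have hA : MeasurableSet {ξ | r + δ ≤ |m ξ - c|} :=
    measurableSet_le measurable_const (hm.sub_const c).abs
  set v := mulOp ν ({ξ | r + δ ≤ |m ξ - c|}.indicator fun _ => (1 : ℂ)) (U x) with hv
  have hq0 : 0 ≤ r / (r + δ) := by positivity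
  have hq1 : r / (r + δ) < 1 := by rw [div_lt_one (by positivity)]; linarith
  have hle : ∀ k : ℕ, ‖v‖ ≤ (r / (r + δ)) ^ k * ‖x‖ := by
    intro k
    obtain ⟨y, -, hy2, hy3⟩ := hV.exists_iterate hE hr hx k
    have h1 : ‖v‖ ≤ ((r + δ) ^ k)⁻¹ * ‖U y‖ := by
      refine Lp.norm_le_mul_norm_of_ae_le_mul ?_
      filter_upwards [coeFn_mulOp (memLp_indicator_one hA) (U x), hy2] with ξ h2 h3
      rw [hv, h2, h3]
      by_cases hξ : ξ ∈ {ξ | r + δ ≤ |m ξ - c|}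
      · rw [Set.indicator_of_mem hξ, one_mul, norm_mul, norm_pow, Complex.norm_real,
          Real.norm_eq_abs, ← mul_assoc]
        refine le_mul_of_one_le_left (norm_nonneg _) ?_
        rw [inv_mul_eq_div, one_le_div (by positivity)]
        exact pow_le_pow_left₀ (by positivity) hξ k
      · rw [Set.indicator_of_notMem hξ, zero_mul, norm_zero]
        positivity
    rw [U.norm_map] at h1
    calc ‖v‖ ≤ ((r + δ) ^ k)⁻¹ * ‖y‖ := h1
      _ ≤ ((r + δ) ^ k)⁻¹ * (r ^ k * ‖x‖) := by gcongr
      _ = (r / (r + δ)) ^ k * ‖x‖ := by rw [div_pow]; ring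
  have hlim : Tendsto (fun k : ℕ => (r / (r + δ)) ^ k * ‖x‖) atTop (𝓝 (0 * ‖x‖)) :=
    (tendsto_pow_atTop_nhds_zero_of_lt_one hq0 hq1).mul_const _
  rw [zero_mul] at hlim
  exact norm_le_zero_iff.1 (ge_of_tendsto' hlim hle)

theorem IsMulModel.sqDensity_compl_eq_zero (hV : IsMulModel V U m) (hE : E.Resolves V)
    (hm : Measurable m) {c r : ℝ} (hr : 0 ≤ r) {x : H}
    (hx : E.proj (Set.Icc (c - r) (c + r)) x = x) :
    sqDensity (U x) (m ⁻¹' Set.Icc (c - r) (c + r))ᶜ = 0 := by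
  have hsub : (m ⁻¹' Set.Icc (c - r) (c + r))ᶜ ⊆
      ⋃ n : ℕ, {ξ | r + 1 / ((n : ℝ) + 1) ≤ |m ξ - c|} := by
    intro ξ hξ
    have h1 : r < |m ξ - c| := by
      by_contra! h2
      refine hξ ?_
      rw [abs_le] at h2
      constructor <;> linarith [h2.1, h2.2]
    obtain ⟨n, hn⟩ := exists_nat_one_div_lt (sub_pos.2 h1)
    refine Set.mem_iUnion.2 ⟨n, ?_⟩
    simp only [Set.mem_ofPred_eq]
    linarith
  refine measure_mono_null hsub (measure_iUnion_null fun n => ?_)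
  rw [sqDensity_apply _ (measurableSet_le measurable_const (hm.sub_const c).abs),
    hV.mulOp_indicator_eq_zero hE hm hr hx (by positivity)]
  simp

/-- With `p = E(I)x`, the function `Up` is supported in `m⁻¹(I)`, so `‖p‖² = ⟪p, x⟫ = ⟪Up, Q(Ux)⟫`,
and Cauchy–Schwarz gives `‖p‖ ≤ ‖Q(Ux)‖`. -/
theorem IsMulModel.measure_Icc_le (hV : IsMulModel V U m) (hE : E.Resolves V)
    (hm : Measurable m) (x : H) (a b : ℝ) :
    E.measure x (Set.Icc a b) ≤ (sqDensity (U x)).map m (Set.Icc a b) := by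
  rcases lt_or_ge b a with hab | hab
  · simp [Set.Icc_eq_empty (not_le.2 hab)]
  obtain ⟨c, r, hr, rfl, rfl⟩ : ∃ c r : ℝ, 0 ≤ r ∧ a = c - r ∧ b = c + r :=
    ⟨(a + b) / 2, (b - a) / 2, by linarith, by ring, by ring⟩
  set I := Set.Icc (c - r) (c + r) with hI
  have hIm : MeasurableSet I := measurableSet_Icc
  rw [E.measure_apply x hIm, Measure.map_apply hm hIm, sqDensity_apply _ (hm hIm)]
  set p := E.proj I x with hp
  have hpp : E.proj I p = p := by rw [hp, E.proj_proj hIm hIm, Set.inter_self]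
  set Q := mulOp ν ((m ⁻¹' I).indicator fun _ => (1 : ℂ)) with hQ
  have hQp : Q (U p) = U p := by
    have h0 := hV.sqDensity_compl_eq_zero hE hm hr hpp
    rw [sqDensity_apply _ (hm hIm).compl, ENNReal.ofReal_eq_zero] at h0
    have h1 : mulOp ν ((m ⁻¹' I)ᶜ.indicator fun _ => (1 : ℂ)) (U p) = 0 := by
      have : ‖mulOp ν ((m ⁻¹' I)ᶜ.indicator fun _ => (1 : ℂ)) (U p)‖ ^ 2 = 0 :=
        le_antisymm h0 (by positivity)
      simpa using this
    apply Lp.ext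
    have h2 := coeFn_mulOp (ν := ν) (memLp_indicator_one (hm hIm).compl) (U p)
    rw [h1] at h2
    filter_upwards [h2, coeFn_mulOp (memLp_indicator_one (hm hIm)) (U p), Lp.coeFn_zero ℂ 2 ν]
      with ξ h3 h4 h5
    rw [hQ, h4]
    rw [h5] at h3
    by_cases hξ : ξ ∈ m ⁻¹' I
    · rw [Set.indicator_of_mem hξ, one_mul]
    · rw [Set.indicator_of_mem (Set.mem_compl hξ), one_mul] at h3
      rw [← h3]
      simp
  have hQs : ∀ f g : Lp ℂ 2 ν, inner ℂ (Q f) g = inner ℂ f (Q g) := by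
    intro f g
    have h1 : ContinuousLinearMap.adjoint Q = Q := by
      rw [← ContinuousLinearMap.star_eq_adjoint, hQ, adjoint_mulOp (memLp_indicator_one (hm hIm))]
      congr 1
      ext ξ
      by_cases hξ : ξ ∈ m ⁻¹' I <;> simp [hξ]
    have h2 := ContinuousLinearMap.adjoint_inner_left Q g f
    rwa [h1] at h2
  have hle : ‖p‖ ≤ ‖Q (U x)‖ := by
    have h1 : ‖p‖ * ‖p‖ ≤ ‖p‖ * ‖Q (U x)‖ := by
      have h2 : inner ℂ p p = inner ℂ p x := by
        nth_rw 2 [hp]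
        rw [← E.inner_proj hIm, hpp]
      have h3 : inner ℂ p x = inner ℂ (U p) (Q (U x)) := by
        rw [← U.inner_map_map, ← hQs, hQp]
      have h4 := norm_inner_le_norm (𝕜 := ℂ) (U p) (Q (U x))
      rw [← h3, ← h2, U.norm_map, inner_self_eq_norm_sq_to_K] at h4
      simpa [pow_two] using h4
    by_cases hp0 : ‖p‖ = 0
    · rw [hp0]; positivity
    · exact le_of_mul_le_mul_left h1 (lt_of_le_of_ne (norm_nonneg _) (Ne.symm hp0))
  gcongr

/-- A finite measure that is dominated by an atomless measure of the same mass on all compact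
intervals is equal to it. -/
theorem measure_eq_of_forall_Icc_le {μ μ' : Measure ℝ} [IsFiniteMeasure μ] [IsFiniteMeasure μ']
    [NullSingletonClass μ'] (h : ∀ a b : ℝ, μ (Set.Icc a b) ≤ μ' (Set.Icc a b))
    (huniv : μ Set.univ = μ' Set.univ) : μ = μ' := by
  have hIic : ∀ b : ℝ, μ (Set.Iic b) ≤ μ' (Set.Iic b) := by
    intro b
    have hU : Set.Iic b = ⋃ n : ℕ, Set.Icc (-n : ℝ) b := by
      ext t
      simp only [Set.mem_Iic, Set.mem_iUnion, Set.mem_Icc, exists_and_right]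
      refine ⟨fun ht => ⟨?_, ht⟩, fun ht => ht.2⟩
      obtain ⟨n, hn⟩ := exists_nat_ge (-t)
      exact ⟨n, by linarith⟩
    have hmono : Monotone fun n : ℕ => Set.Icc (-n : ℝ) b := fun i j hij =>
      Set.Icc_subset_Icc_left (neg_le_neg (Nat.cast_le.2 hij))
    rw [hU, hmono.measure_iUnion]
    refine iSup_le fun n => (h _ _).trans (measure_mono (Set.subset_iUnion_of_subset n subset_rfl))
  have hIci : ∀ a : ℝ, μ (Set.Ici a) ≤ μ' (Set.Ici a) := by
    intro a
    have hU : Set.Ici a = ⋃ n : ℕ, Set.Icc a (n : ℝ) := by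
      ext t
      simp only [Set.mem_Ici, Set.mem_iUnion, Set.mem_Icc, exists_and_left]
      exact ⟨fun ht => ⟨ht, exists_nat_ge t⟩, fun ht => ht.1⟩
    have hmono : Monotone fun n : ℕ => Set.Icc a (n : ℝ) := fun i j hij =>
      Set.Icc_subset_Icc_right (Nat.cast_le.2 hij)
    rw [hU, hmono.measure_iUnion]
    refine iSup_le fun n => (h _ _).trans (measure_mono (Set.subset_iUnion_of_subset n subset_rfl))
  refine Measure.ext_of_Iic μ μ' fun a => le_antisymm (hIic a) ?_
  -- The reverse inequality comes from complements. Absence of atoms for `μ'` makes the endpoint `a`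
  -- harmless.
  have h1 : μ (Set.Iic a) = μ Set.univ - μ (Set.Ioi a) := by
    rw [← measure_compl measurableSet_Ioi (measure_ne_top _ _), Set.compl_Ioi]
  have h2 : μ' (Set.Iic a) = μ' Set.univ - μ' (Set.Ici a) := by
    rw [← measure_compl measurableSet_Ici (measure_ne_top _ _), Set.compl_Ici,
      measure_congr Iio_ae_eq_Iic]
  rw [h1, h2, huniv]
  exact tsub_le_tsub_left ((measure_mono Set.Ioi_subset_Ici_self).trans (hIci a)) _

/-- The spectral measures of an operator that is unitarily equivalent to multiplication by a
function with null level sets. -/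
theorem IsMulModel.measure_eq (hV : IsMulModel V U m) (hE : E.Resolves V) (hm : Measurable m)
    (hatom : ∀ t : ℝ, ν (m ⁻¹' {t}) = 0) (x : H) : E.measure x = (sqDensity (U x)).map m := by
  have : NullSingletonClass ((sqDensity (U x)).map m) := by
    refine ⟨fun t => ?_⟩
    rw [Measure.map_apply hm (measurableSet_singleton t)]
    exact sqDensity_absolutelyContinuous _ (hatom t)
  refine measure_eq_of_forall_Icc_le (hV.measure_Icc_le hE hm x) ?_
  rw [E.measure_univ, Measure.map_apply hm MeasurableSet.univ, sqDensity, Set.preimage_univ,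
    withDensity_apply _ MeasurableSet.univ, Measure.restrict_univ, ← ofReal_norm_sq_eq_lintegral,
    U.norm_map]

/-- The functional calculus of an operator that is unitarily equivalent to multiplication by a
function with null level sets. -/
theorem IsMulModel.borelCalculus_eq (hV : IsMulModel V U m) (hm : Measurable m)
    (hatom : ∀ t : ℝ, ν (m ⁻¹' {t}) = 0) {g : ℝ → ℂ} (hg : Measurable g)
    (hgb : MemLp (fun ξ => g (m ξ)) ⊤ ν) :
    borelCalculus V g = U.conjStarAlgEquiv.symm (mulOp ν fun ξ => g (m ξ)) := by
  set B := U.conjStarAlgEquiv.symm (mulOp ν fun ξ => g (m ξ)) with hB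
  have hinner : ∀ x : H, inner ℂ x (B x) = ∫ t, g t ∂((sqDensity (U x)).map m) := by
    intro x
    rw [integral_map hm.aemeasurable hg.aestronglyMeasurable, integral_sqDensity,
      ← inner_mulOp hgb, ← U.inner_map_map x]
    congr 1
    exact U.apply_symm_apply _
  have hint : ∀ x : H, Integrable g ((sqDensity (U x)).map m) := by
    intro x
    rw [integrable_map_measure hg.aestronglyMeasurable hm.aemeasurable]
    have h1 : MemLp (g ∘ m) ⊤ (sqDensity (U x)) :=
      ⟨(hg.comp hm).aestronglyMeasurable,
        (eLpNorm_exponent_top (f := g ∘ m) ▸ (eLpNormEssSup_mono_measure _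
          (sqDensity_absolutelyContinuous (U x))).trans_lt
            (eLpNorm_exponent_top (μ := ν) (f := g ∘ m) ▸ hgb.2))⟩
    exact h1.integrable (by simp)
  have hex : ∃ B, IsBorelCalculus V g B :=
    ⟨B, mulPVM U m hm, hV.resolves_mulPVM hm, fun x => by
      rw [mulPVM_measure]
      exact ⟨hint x, hinner x⟩⟩
  rw [borelCalculus, dif_pos hex]
  -- The chosen operator comes with its own `E`. Uniqueness of the scalar measures equates the
  -- quadratic forms, which determine an operator on a complex space.
  obtain ⟨E, hE, hx⟩ := hex.choose_spec
  refine ContinuousLinearMap.coe_injective ((ext_inner_map _ _).1 fun x => ?_)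
  have h1 := (hx x).2
  rw [hV.measure_eq hE hm hatom, ← hinner] at h1
  rw [← inner_conj_symm, ContinuousLinearMap.coe_coe, h1, inner_conj_symm]
  rfl

end Uniqueness

/-! ### Diagonalization of the momentum operator -/

section Momentum

theorem weight_ac_volume (c : ℝ) : weight c ≪ volume :=
  withDensity_absolutelyContinuous _ _

theorem eLpNorm_weight (c : ℝ) (f : ℝ → ℂ) :
    eLpNorm f 2 (weight c) = eLpNorm (fun t => (Real.exp (-c * t) : ℂ) * f t) 2 volume := by
  rw [eLpNorm_eq_lintegral_rpow_enorm_toReal (by norm_num) (by norm_num),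
    eLpNorm_eq_lintegral_rpow_enorm_toReal (by norm_num) (by norm_num), weight,
    lintegral_withDensity_eq_lintegral_mul_non_measurable _ (by fun_prop)
      (ae_of_all _ fun t => ENNReal.ofReal_lt_top)]
  congr 1
  refine lintegral_congr fun t => ?_
  simp only [Pi.mul_apply, ENNReal.toReal_ofNat, ENNReal.rpow_ofNat, enorm_mul, mul_pow]
  congr 1
  rw [← ofReal_norm, Complex.norm_real, Real.norm_of_nonneg (Real.exp_pos _).le,
    ← ENNReal.ofReal_pow (Real.exp_pos _).le, ← Real.exp_nat_mul]
  congr 2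
  push_cast
  ring

theorem memLp_weight_iff (c : ℝ) (f : ℝ → ℂ) :
    MemLp f 2 (weight c) ↔ MemLp (fun t => (Real.exp (-c * t) : ℂ) * f t) 2 volume := by
  rw [MemLp, MemLp, eLpNorm_weight]
  refine and_congr_left fun _ => ⟨fun h => ?_, fun h => ?_⟩
  · refine AEStronglyMeasurable.mul ?_ (h.mono_ac (volume_ac_weight c))
    exact Continuous.aestronglyMeasurable (by fun_prop)
  · have h1 : AEStronglyMeasurable (fun t : ℝ => (Real.exp (c * t) : ℂ)) volume :=
      Continuous.aestronglyMeasurable (by fun_prop)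
    refine ((h1.mul h).congr (ae_of_all _ fun t => ?_)).mono_ac (weight_ac_volume c)
    simp only [Pi.mul_apply]
    rw [← mul_assoc, ← Complex.ofReal_mul, ← Real.exp_add]
    simp

/-- The unitary `f ↦ e^{-ct} f` from `ℍ_c` onto `L²(ℝ)`, as a linear isometry. -/
noncomputable def unweightLI (c : ℝ) : HSpace c →ₗᵢ[ℂ] Lp ℂ 2 (volume : Measure ℝ) where
  toFun f := ((memLp_weight_iff c f).1 (Lp.memLp f)).toLp _
  map_add' f g := by
    apply Lp.ext
    filter_upwards [((memLp_weight_iff c (f + g : HSpace c)).1 (Lp.memLp (f + g))).coeFn_toLp,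
      ((memLp_weight_iff c f).1 (Lp.memLp f)).coeFn_toLp,
      ((memLp_weight_iff c g).1 (Lp.memLp g)).coeFn_toLp,
      (volume_ac_weight c).ae_le (Lp.coeFn_add f g),
      Lp.coeFn_add (((memLp_weight_iff c f).1 (Lp.memLp f)).toLp _)
        (((memLp_weight_iff c g).1 (Lp.memLp g)).toLp _)] with t h1 h2 h3 h4 h5
    rw [h1, h5, Pi.add_apply, h2, h3, h4, Pi.add_apply, mul_add]
  map_smul' k f := by
    apply Lp.ext
    filter_upwards [((memLp_weight_iff c (k • f : HSpace c)).1 (Lp.memLp (k • f))).coeFn_toLp,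
      ((memLp_weight_iff c f).1 (Lp.memLp f)).coeFn_toLp,
      (volume_ac_weight c).ae_le (Lp.coeFn_smul k f),
      Lp.coeFn_smul k (((memLp_weight_iff c f).1 (Lp.memLp f)).toLp _)] with t h1 h2 h3 h4
    rw [h1, RingHom.id_apply, h4, Pi.smul_apply, h2, h3, Pi.smul_apply, smul_eq_mul, smul_eq_mul]
    ring
  norm_map' f := by
    change ‖((memLp_weight_iff c f).1 (Lp.memLp f)).toLp _‖ = ‖f‖
    rw [Lp.norm_toLp, ← eLpNorm_weight, Lp.norm_def]

theorem coeFn_unweightLI (c : ℝ) (f : HSpace c) :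
    ∀ᵐ t : ℝ, unweightLI c f t = (Real.exp (-c * t) : ℂ) * f t :=
  ((memLp_weight_iff c f).1 (Lp.memLp f)).coeFn_toLp

theorem unweightLI_surjective (c : ℝ) : Function.Surjective (unweightLI c) := by
  intro g
  have hexp : ∀ t : ℝ, (Real.exp (-c * t) : ℂ) * ((Real.exp (c * t) : ℂ) * g t) = g t := by
    intro t
    rw [← mul_assoc, ← Complex.ofReal_mul, ← Real.exp_add]
    simp
  have h : MemLp (fun t => (Real.exp (c * t) : ℂ) * g t) 2 (weight c) := by
    rw [memLp_weight_iff]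
    simp only [hexp]
    exact Lp.memLp g
  refine ⟨h.toLp _, Lp.ext ?_⟩
  filter_upwards [coeFn_unweightLI c (h.toLp _), (volume_ac_weight c).ae_le h.coeFn_toLp]
    with t h1 h2
  rw [h1, h2, hexp]

/-- The unitary `f ↦ e^{-ct} f` from `ℍ_c` onto `L²(ℝ)`. -/
noncomputable def unweight (c : ℝ) : HSpace c ≃ₗᵢ[ℂ] Lp ℂ 2 (volume : Measure ℝ) :=
  LinearIsometryEquiv.ofSurjective (unweightLI c) (unweightLI_surjective c)

theorem coeFn_unweight (c : ℝ) (f : HSpace c) :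
    ∀ᵐ t : ℝ, unweight c f t = (Real.exp (-c * t) : ℂ) * f t :=
  coeFn_unweightLI c f

theorem infinitesimalShift_graph (c : ℝ) : (infinitesimalShift c).graph = shiftGraph c :=
  Submodule.toLinearPMap_graph_eq _ (shiftGraph_functional c)

theorem mem_momentum_graph_iff (c : ℝ) (x y : HSpace c) :
    (x, y) ∈ (momentum c).graph ↔ (x, Complex.I • y + (c : ℂ) • x) ∈ shiftGraph c := by
  rw [← infinitesimalShift_graph, LinearPMap.mem_graph_iff, LinearPMap.mem_graph_iff]
  constructor
  · rintro ⟨z, hz1, hz2⟩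
    refine ⟨z, hz1, ?_⟩
    have h1 : momentum c z =
        Complex.I⁻¹ • (-((c : ℂ) • (z : HSpace c)) + infinitesimalShift c z) := rfl
    simp only at hz1 hz2 ⊢
    rw [← hz2, h1, smul_smul, mul_inv_cancel₀ Complex.I_ne_zero, one_smul, hz1]
    abel
  · rintro ⟨z, hz1, hz2⟩
    refine ⟨z, hz1, ?_⟩
    have h1 : momentum c z =
        Complex.I⁻¹ • (-((c : ℂ) • (z : HSpace c)) + infinitesimalShift c z) := rfl
    simp only at hz1 hz2 ⊢
    rw [h1, hz2, hz1, neg_add_eq_sub, add_sub_cancel_right, smul_smul,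
      inv_mul_cancel₀ Complex.I_ne_zero, one_smul]

theorem hasDerivAt_exp_mul (k t : ℝ) :
    HasDerivAt (fun s : ℝ => (Real.exp (k * s) : ℂ)) ((k : ℂ) * Real.exp (k * t)) t := by
  have h : HasDerivAt (fun s : ℝ => Real.exp (k * s)) (k * Real.exp (k * t)) t := by
    have := ((hasDerivAt_id t).const_mul k).exp
    simpa [mul_comm] using this
  simpa using h.ofReal_comp

theorem absolutelyContinuousOnInterval_exp_mul (k : ℝ) {u : ℝ → ℂ} {a b : ℝ}
    (hu : AbsolutelyContinuousOnInterval u a b) :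
    AbsolutelyContinuousOnInterval (fun t => (Real.exp (k * t) : ℂ) * u t) a b := by
  have h : ContDiff ℝ 1 fun t : ℝ => (Real.exp (k * t) : ℂ) :=
    Complex.ofRealCLM.contDiff.comp (Real.contDiff_exp.comp (contDiff_const.mul contDiff_id))
  exact h.contDiffOn.absolutelyContinuousOnInterval.smul hu

/-- If `u' = iy + cu`, the product rule gives `(e^{-ct}u)' = i e^{-ct}y`: the weight absorbs the
shift by `c`. -/
theorem mem_momentum_graph_iff_hasACDeriv (c : ℝ) (x y : HSpace c) :
    (x, y) ∈ (momentum c).graph ↔ HasACDeriv (unweight c x) (Complex.I • unweight c y) := by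
  rw [mem_momentum_graph_iff]
  have hcoe : ∀ᵐ t : ℝ, ((Complex.I • y + (c : ℂ) • x : HSpace c) : ℝ → ℂ) t =
      Complex.I * y t + c * x t := by
    refine (volume_ac_weight c).ae_le ?_
    filter_upwards [Lp.coeFn_add (Complex.I • y) ((c : ℂ) • x), Lp.coeFn_smul Complex.I y,
      Lp.coeFn_smul (c : ℂ) x] with t h1 h2 h3
    rw [h1, Pi.add_apply, h2, h3]
    rfl
  constructor
  · rintro ⟨u, hu, hxu, hu'⟩
    refine ⟨fun t => (Real.exp (-c * t) : ℂ) * u t,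
      fun a b => absolutelyContinuousOnInterval_exp_mul _ (hu a b), ?_, ?_⟩
    · filter_upwards [coeFn_unweight c x, (volume_ac_weight c).ae_le hxu] with t h1 h2
      rw [h1, h2]
    · filter_upwards [coeFn_unweight c y, Lp.coeFn_smul Complex.I (unweight c y), hcoe,
        (volume_ac_weight c).ae_le hxu, (volume_ac_weight c).ae_le hu'] with t h1 h2 h3 h4 h5
      rw [h3] at h5
      have h6 : (Complex.I • unweight c y : Lp ℂ 2 (volume : Measure ℝ)) t =
          ((-c : ℝ) : ℂ) * Real.exp (-c * t) * u t +
            Real.exp (-c * t) * (Complex.I * y t + c * x t) := by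
        rw [h2, Pi.smul_apply, h1, h4, smul_eq_mul]
        push_cast
        ring
      rw [h6]
      exact (hasDerivAt_exp_mul (-c) t).mul h5
  · rintro ⟨u, hu, hxu, hu'⟩
    refine ⟨fun t => (Real.exp (c * t) : ℂ) * u t,
      fun a b => absolutelyContinuousOnInterval_exp_mul _ (hu a b), ?_, ?_⟩
    · refine (weight_ac_volume c).ae_le ?_
      filter_upwards [coeFn_unweight c x, hxu] with t h1 h2
      rw [← h2, h1, ← mul_assoc, ← Complex.ofReal_mul, ← Real.exp_add]
      simp
    · refine (weight_ac_volume c).ae_le ?_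
      filter_upwards [coeFn_unweight c y, Lp.coeFn_smul Complex.I (unweight c y), hcoe,
        coeFn_unweight c x, hxu, hu'] with t h1 h2 h3 h4 h5 h6
      have hexp : (Real.exp (c * t) : ℂ) * Real.exp (-c * t) = 1 := by
        rw [← Complex.ofReal_mul, ← Real.exp_add]
        simp
      have h7 : (Complex.I • y + (c : ℂ) • x : HSpace c) t = (c : ℂ) * Real.exp (c * t) * u t +
          Real.exp (c * t) * (Complex.I • unweight c y : Lp ℂ 2 (volume : Measure ℝ)) t := by
        rw [h3, h2, Pi.smul_apply, h1, ← h5, h4, smul_eq_mul]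
        linear_combination (-(Complex.I * y t) - c * x t) * hexp
      rw [h7]
      exact (hasDerivAt_exp_mul c t).mul h6

/-- The unitary that diagonalizes the momentum operator. -/
noncomputable def momentumUnitary (c : ℝ) : HSpace c ≃ₗᵢ[ℂ] Lp ℂ 2 (volume : Measure ℝ) :=
  (unweight c).trans (Lp.fourierTransformₗᵢ ℝ ℂ)

theorem isMulModel_momentum (c : ℝ) :
    IsMulModel (momentum c) (momentumUnitary c) fun ξ => 2 * Real.pi * ξ := by
  intro x y
  rw [mem_momentum_graph_iff_hasACDeriv, hasACDeriv_iff_fourier]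
  have h1 : FourierTransform.fourier (Complex.I • unweight c y) =
      Complex.I • momentumUnitary c y :=
    (Lp.fourierTransformₗᵢ ℝ ℂ).map_smul Complex.I _
  have h2 : FourierTransform.fourier (unweight c x) = momentumUnitary c x := rfl
  rw [h1, h2]
  refine eventually_congr ?_
  filter_upwards [Lp.coeFn_smul Complex.I (momentumUnitary c y)] with ξ h3
  rw [h3, Pi.smul_apply, smul_eq_mul]
  push_cast
  constructor
  · intro h
    refine mul_left_cancel₀ Complex.I_ne_zero ?_
    rw [h]
    ring
  · intro h
    rw [h]
    ring

end Momentum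

/-! ### The truncated spectral operator -/

section Truncation

/-- The complement of the essential range is locally null for the image measure, hence null because
`ℝ` is second countable. -/
theorem ae_mem_essRange {φ : ℝ → ℝ} (hφ : Measurable φ) (hc : IsClosed (essRange φ)) :
    ∀ᵐ t : ℝ, φ t ∈ essRange φ := by
  have h0 : (volume.map φ) (essRange φ)ᶜ = 0 := by
    refine measure_null_of_locally_null _ fun y hy => ?_
    simp only [essRange, Set.mem_compl_iff, Set.mem_ofPred_eq, not_forall, not_lt,
      nonpos_iff_eq_zero] at hy
    obtain ⟨W, hW, h0⟩ := hy
    refine ⟨interior W, mem_nhdsWithin_of_mem_nhds (interior_mem_nhds.2 hW), ?_⟩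
    rw [Measure.map_apply hφ isOpen_interior.measurableSet]
    exact measure_mono_null (Set.preimage_mono interior_subset) h0
  rw [Measure.map_apply hφ hc.measurableSet.compl] at h0
  exact h0

theorem volume_preimage_two_pi_mul_eq_zero_iff (s : Set ℝ) :
    volume ((fun ξ : ℝ => 2 * Real.pi * ξ) ⁻¹' s) = 0 ↔ volume s = 0 := by
  rw [Real.volume_preimage_mul_left (by positivity)]
  have : (0 : ℝ) < |(2 * Real.pi)⁻¹| := by positivity
  rw [mul_eq_zero, or_iff_right (ENNReal.ofReal_pos.2 this).ne']

theorem measurable_two_pi_mul : Measurable fun ξ : ℝ => 2 * Real.pi * ξ :=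
  measurable_const.mul measurable_id

theorem memLp_top_ofReal_comp_two_pi_mul {φ : ℝ → ℝ} (hφ : Measurable φ) {T : ℝ}
    (hT : ∀ᵐ t : ℝ, |φ t| ≤ T) : MemLp (fun ξ : ℝ => (φ (2 * Real.pi * ξ) : ℂ)) ⊤ volume := by
  refine memLp_top_of_bound (C := T) ?_ ?_
  · exact (Complex.measurable_ofReal.comp
      (hφ.comp measurable_two_pi_mul)).aestronglyMeasurable
  · have h := (volume_preimage_two_pi_mul_eq_zero_iff _).2 (ae_iff.1 hT)
    rw [ae_iff]
    simpa using h

theorem memLp_top_add_I_mul {φ : ℝ → ℝ} (hφ : Measurable φ) {T : ℝ}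
    (hT : ∀ᵐ t : ℝ, |φ t| ≤ T) (c : ℝ) :
    MemLp (fun ξ : ℝ => (c : ℂ) + Complex.I * φ (2 * Real.pi * ξ)) ⊤ volume := by
  have h1 : MemLp (fun _ : ℝ => (c : ℂ)) ⊤ volume := memLp_top_const _
  have h2 : MemLp (fun ξ : ℝ => Complex.I * (φ (2 * Real.pi * ξ) : ℂ)) ⊤ volume :=
    (memLp_top_ofReal_comp_two_pi_mul hφ hT).const_mul _
  exact h1.add h2

theorem truncatedShift_eq (c : ℝ) {φ : ℝ → ℝ} (hφ : Measurable φ) {T : ℝ}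
    (hT : ∀ᵐ t : ℝ, |φ t| ≤ T) :
    truncatedShift c φ = (momentumUnitary c).conjStarAlgEquiv.symm
      (mulOp volume fun ξ : ℝ => (c : ℂ) + Complex.I * φ (2 * Real.pi * ξ)) := by
  have hb := memLp_top_ofReal_comp_two_pi_mul hφ hT
  have hatom : ∀ t : ℝ, volume ((fun ξ : ℝ => 2 * Real.pi * ξ) ⁻¹' {t}) = 0 := fun t =>
    (volume_preimage_two_pi_mul_eq_zero_iff _).2 (measure_singleton t)
  have hI : MemLp (fun _ : ℝ => Complex.I) ⊤ volume := memLp_top_const _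
  have hIb : MemLp (fun ξ : ℝ => Complex.I * (φ (2 * Real.pi * ξ) : ℂ)) ⊤ volume :=
    hb.const_mul _
  have hφm : Measurable fun t : ℝ => (φ t : ℂ) := Complex.measurable_ofReal.comp hφ
  rw [truncatedShift, (isMulModel_momentum c).borelCalculus_eq measurable_two_pi_mul hatom
    hφm hb, mulOp_add (memLp_top_const _) hIb, mulOp_mul hI hb,
    mulOp_const, mulOp_const, map_add, smul_one_mul, map_smul, map_smul, map_one]

theorem isStarNormal_truncatedShift (c : ℝ) {φ : ℝ → ℝ} (hφ : Measurable φ) {T : ℝ}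
    (hT : ∀ᵐ t : ℝ, |φ t| ≤ T) : IsStarNormal (truncatedShift c φ) := by
  rw [truncatedShift_eq c hφ hT]
  have hg := memLp_top_add_I_mul hφ hT c
  have := isStarNormal_mulOp hg
  exact IsStarNormal.map _ _

theorem mem_spectrum_truncatedShift_iff (c : ℝ) {φ : ℝ → ℝ} (hφ : Measurable φ) {T : ℝ}
    (hT : ∀ᵐ t : ℝ, |φ t| ≤ T) (z : ℂ) :
    z ∈ spectrum ℂ (truncatedShift c φ) ↔ z.re = c ∧ z.im ∈ essRange φ := by
  have hg := memLp_top_add_I_mul hφ hT c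
  have hgm : Measurable fun ξ : ℝ => (c : ℂ) + Complex.I * φ (2 * Real.pi * ξ) :=
    ((Complex.measurable_ofReal.comp (hφ.comp measurable_two_pi_mul)).const_mul _).const_add _
  have hpos : ∀ ε : ℝ,
      0 < volume {ξ : ℝ | ‖z - ((c : ℂ) + Complex.I * φ (2 * Real.pi * ξ))‖ < ε} ↔
      0 < volume {t : ℝ | ‖z - ((c : ℂ) + Complex.I * φ t)‖ < ε} := by
    intro ε
    rw [pos_iff_ne_zero, pos_iff_ne_zero]
    exact not_congr (volume_preimage_two_pi_mul_eq_zero_iff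
      {t : ℝ | ‖z - ((c : ℂ) + Complex.I * φ t)‖ < ε})
  rw [truncatedShift_eq c hφ hT, AlgEquiv.spectrum_eq, mem_spectrum_mulOp_iff hg hgm]
  simp only [hpos]
  constructor
  · intro h
    have hre : z.re = c := by
      by_contra hne
      obtain ⟨t, ht⟩ := nonempty_of_measure_ne_zero
        -- The symbol takes values on the line `Re = c`, so a disc of this radius around `z` misses
        -- it.
        (h |z.re - c| (abs_pos.2 (sub_ne_zero.2 hne))).ne'
      have h1 := Complex.abs_re_le_norm (z - ((c : ℂ) + Complex.I * φ t))
      simp only [Complex.sub_re, Complex.add_re, Complex.ofReal_re, Complex.mul_re, Complex.I_re,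
        Complex.I_im, Complex.ofReal_im, zero_mul, mul_zero, sub_zero, add_zero] at h1
      exact absurd ht (not_lt.2 h1)
    refine ⟨hre, fun W hW => ?_⟩
    obtain ⟨ε, hε, hball⟩ := Metric.mem_nhds_iff.1 hW
    refine (h ε hε).trans_le (measure_mono fun t ht => hball ?_)
    have h1 := Complex.abs_im_le_norm (z - ((c : ℂ) + Complex.I * φ t))
    simp only [Complex.sub_im, Complex.add_im, Complex.ofReal_re, Complex.mul_im, Complex.I_re,
      Complex.I_im, Complex.ofReal_im, zero_mul, one_mul, zero_add] at h1
    rw [Metric.mem_ball, dist_comm, Real.dist_eq]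
    exact h1.trans_lt ht
  · rintro ⟨hre, him⟩ ε hε
    refine (him _ (Metric.ball_mem_nhds _ hε)).trans_le (measure_mono fun t ht => ?_)
    have hz : z - ((c : ℂ) + Complex.I * φ t) = ((z.im - φ t : ℝ) : ℂ) * Complex.I := by
      conv_lhs => rw [← Complex.re_add_im z, hre]
      push_cast
      ring
    rw [Set.mem_preimage, Metric.mem_ball, dist_comm, Real.dist_eq] at ht
    simpa [hz, -Complex.ofReal_sub] using ht

/-- Spectral mapping for the normal operator `c + iφ(V_c)`. The condition `c ≠ 1` keeps the pole of
`ζ` off the spectrum. -/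
theorem isUnit_truncatedSpectralOperator_iff {c : ℝ} (hc : c ≠ 1) {T₀ T : ℝ} {φ : ℝ → ℝ}
    (hφ : IsAdmissibleCutoff T₀ T φ) :
    IsUnit (truncatedSpectralOperator c φ) ↔
      ∀ z : ℂ, z.re = c → T₀ ≤ |z.im| → |z.im| ≤ T → riemannZeta z ≠ 0 := by
  obtain ⟨hm, hr⟩ := hφ
  have hclosed : IsClosed (essRange φ) := by
    rw [hr]
    exact (isClosed_le continuous_const continuous_abs).inter
      (isClosed_le continuous_abs continuous_const)
  have hT : ∀ᵐ t : ℝ, |φ t| ≤ T := by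
    filter_upwards [ae_mem_essRange hm hclosed] with t ht
    rw [hr] at ht
    exact ht.2
  have hspec := mem_spectrum_truncatedShift_iff c hm hT
  have hnormal := isStarNormal_truncatedShift c hm hT
  have hcont : ContinuousOn riemannZeta (spectrum ℂ (truncatedShift c φ)) := by
    intro z hz
    refine (differentiableAt_riemannZeta fun h1 => hc ?_).continuousAt.continuousWithinAt
    rw [← ((hspec z).1 hz).1, h1, Complex.one_re]
  rw [truncatedSpectralOperator, isUnit_cfc_iff riemannZeta _ hcont hnormal]
  simp only [hspec, hr]
  exact ⟨fun h z h1 h2 h3 => h z ⟨h1, h2, h3⟩, fun h z hz => h z hz.1 hz.2.1 hz.2.2⟩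

/-- Almost invertibility means that the zeros of `ζ` on the line `Re s = c` are bounded. -/
theorem almostInvertible_iff_finite {c : ℝ} (hc : c ≠ 1) {φ : ℝ → ℝ → ℝ → ℝ}
    (hφ : ∀ T₀ T : ℝ, 0 ≤ T₀ → T₀ < T → IsAdmissibleCutoff T₀ T (φ T₀ T)) :
    AlmostInvertible c φ ↔ {s : ℂ | s.re = c ∧ riemannZeta s = 0}.Finite := by
  constructor
  · rintro ⟨T₀, hT₀, h⟩
    have hcomp : IsCompact (Set.Icc c c ×ℂ Set.Icc (-T₀) T₀) :=
      isCompact_Icc.reProdIm isCompact_Icc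
    refine hcomp.inter_riemannZetaZeros_finite.subset ?_
    rintro s ⟨hs, hs0⟩
    refine ⟨⟨by simp [hs], ?_⟩, mem_riemannZetaZeros.2 hs0⟩
    by_contra hns
    have h1 : T₀ < |s.im| := by
      by_contra! h2
      exact hns (abs_le.1 h2)
    -- A zero `s` above height `T₀` is excluded by the truncation with `T = |Im s|`.
    exact (isUnit_truncatedSpectralOperator_iff hc (hφ T₀ _ hT₀ h1)).1 (h _ h1) s hs h1.le le_rfl
      hs0
  · intro hfin
    obtain ⟨M, hM⟩ := (hfin.image fun s : ℂ => |s.im|).bddAbove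
    -- The `+ 1` puts `T₀` strictly above all zeros, since the spectrum includes the height `T₀`
    -- itself.
    refine ⟨max M 0 + 1, by positivity, fun T hT => ?_⟩
    rw [isUnit_truncatedSpectralOperator_iff hc (hφ _ T (by positivity) hT)]
    intro z hz h1 _ h0
    have h2 : |z.im| ≤ M := hM ⟨z, ⟨hz, h0⟩, rfl⟩
    linarith [le_max_left M 0]

end Truncation

end SpectralOp

theorem theorem6p3 (φ : ℝ → ℝ → ℝ → ℝ → ℝ)
    (hφ : ∀ c ∈ Set.Ioo (1 / 2 : ℝ) 1, ∀ T₀ T : ℝ, 0 ≤ T₀ → T₀ < T →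
      SpectralOp.IsAdmissibleCutoff T₀ T (φ c T₀ T)) :
    (∀ c ∈ Set.Ioo (1 / 2 : ℝ) 1, SpectralOp.AlmostInvertible c (φ c)) ↔
      SpectralOp.AlmostRH := by
  constructor
  · intro h c hc
    rcases lt_or_ge c 1 with h1 | h1
    · exact (SpectralOp.almostInvertible_iff_finite h1.ne (hφ c ⟨hc, h1⟩)).1 (h c ⟨hc, h1⟩)
    · refine Set.finite_empty.subset ?_
      rintro s ⟨hs, hs0⟩
      exact riemannZeta_ne_zero_of_one_le_re (hs ▸ h1) hs0
  · intro h c hc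
    exact (SpectralOp.almostInvertible_iff_finite hc.2.ne (hφ c hc)).2 (h c hc.1)
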